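/- A matrix $A\in GL(n,\mathbb Z)$ is called bipositive if the standard basis of $\mathbb R^n$ can be partitioned into two parts $P$ and $Q$ such that $A$ is non-negative with respect to the basis $P\cup Q$ and $A^{-1}$ is non-negative with respect to the basis $P\cup(-Q)$. The positive eigenvalue of $A$ (respectively of $A^{-1}$) is its Perron--Frobenius eigenvalue: the positive eigenvalue that has a nonzero eigenvector in the closed orthant spanned by $P\cup Q$ (respectively $P\cup(-Q)$) and is at least the modulus of every complex eigenvalue. Let $a,b$ be real numbers. A pair $(a,b)$ of positive reals such that $a$ and $b^{-1}$ are algebraic units and $b^{-1}\le a$ is a (strict) conjugate pinching pair if all Galois conjugates over $\mathbb Q$ of $a$ and of $b^{-1}$, other than $a$ and $b^{-1}$ themselves, lie in the open annulus $b^{-1}<|z|<a$. It is a weak conjugate pinching pair if all Galois conjugates of $a$ and of $b^{-1}$ lie in the closed annulus $b^{-1}\le|z|\le a$. Theorem. There are an integer $n$ and a bipositive matrix $A\in GL(n,\mathbb Z)$ such that $a$ is the positive eigenvalue of $A$ and $b$ is the positive eigenvalue of $A^{-1}$ if and only if one of the following holds: 1. $(a,b)$ is a (strict) conjugate pinching pair;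 2. $(a,b)$ is a weak conjugate pinching pair, and every Galois conjugate of $a$ or of $b^{-1}$ whose modulus is $a$ or $b^{-1}$ equals $a$ or $b^{-1}$ times a root of unity. -/

import Mathlib

open scoped MatrixGroups

noncomputable section

/-- The linear map `f` is non-negative with respect to the basis `B`: it maps every vector of `B`
to a non-negative linear combination of vectors of `B`. -/
def IsNonnegWrt {ι V : Type*} [AddCommGroup V] [Module ℝ V]
    (B : Module.Basis ι ℝ V) (f : V →ₗ[ℝ] V) : Prop :=
  ∀ j i, 0 ≤ B.repr (f (B j)) i

open Classical in
/-- The basis obtained from `B` by negating the basis vectors whose index is in `Q`. -/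
def flipBasis {ι V : Type*} [AddCommGroup V] [Module ℝ V]
    (B : Module.Basis ι ℝ V) (Q : Set ι) : Module.Basis ι ℝ V :=
  B.unitsSMul (fun i => if i ∈ Q then (-1 : ℝˣ) else 1)

/-- The invertible linear map `f` is bipositive with respect to the basis `B`, partitioned into the
parts indexed by `P` and `Q`: `f` is non-negative with respect to `B = P ∪ Q`, and its inverse is
non-negative with respect to `P ∪ -Q`. -/
structure IsBipositiveWrt {ι V : Type*} [AddCommGroup V] [Module ℝ V]
    (B : Module.Basis ι ℝ V) (P Q : Set ι) (f : V ≃ₗ[ℝ] V) : Prop where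
  partition : IsCompl P Q
  nonneg : IsNonnegWrt B (f : V →ₗ[ℝ] V)
  nonneg_symm : IsNonnegWrt (flipBasis B Q) (f.symm : V →ₗ[ℝ] V)

/-- `r` is the positive (Perron-Frobenius) eigenvalue of `f`, for the orthant spanned by `B`:
it is positive, has a nonzero eigenvector in the orthant, and is at least the modulus of
every complex eigenvalue of `f`. -/
structure IsPositiveEigenvalue {ι V : Type*} [AddCommGroup V] [Module ℝ V]
    [Module.Finite ℝ V] (B : Module.Basis ι ℝ V) (f : V →ₗ[ℝ] V) (r : ℝ) : Prop where
  pos : 0 < r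
  exists_eigenvector : ∃ v : V, v ≠ 0 ∧ (∀ i, 0 ≤ B.repr v i) ∧ f v = r • v
  dominant : ∀ μ : ℂ, Polynomial.aeval μ f.charpoly = 0 → ‖μ‖ ≤ r

/-- The invertible linear transformation of `ℝⁿ` defined by a matrix in `GL(n, ℤ)`. -/
def realEquiv {n : ℕ} (A : GL (Fin n) ℤ) : (Fin n → ℝ) ≃ₗ[ℝ] (Fin n → ℝ) :=
  LinearMap.GeneralLinearGroup.generalLinearEquiv ℝ (Fin n → ℝ)
    (Matrix.GeneralLinearGroup.toLin (Matrix.GeneralLinearGroup.map (Int.castRingHom ℝ) A))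

/-- `(a, b)` is the pair of positive eigenvalues of some bipositive matrix in `GL(n, ℤ)` and of its
inverse, for some dimension `n`. -/
def IsBipositiveEigenvaluePair (a b : ℝ) : Prop :=
  ∃ (n : ℕ) (A : GL (Fin n) ℤ) (P Q : Set (Fin n)),
    IsBipositiveWrt (Pi.basisFun ℝ (Fin n)) P Q (realEquiv A) ∧
    IsPositiveEigenvalue (Pi.basisFun ℝ (Fin n)) (realEquiv A).toLinearMap a ∧
    IsPositiveEigenvalue (flipBasis (Pi.basisFun ℝ (Fin n)) Q) (realEquiv A).symm.toLinearMap b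

/-- A real number which is a unit of the ring of algebraic integers. -/
def IsAlgebraicUnit (x : ℝ) : Prop :=
  x ≠ 0 ∧ IsIntegral ℤ x ∧ IsIntegral ℤ x⁻¹

/-- The complex number `z` is a Galois conjugate (over `ℚ`) of `a` or of `b⁻¹`. -/
def IsConjOfPair (a b : ℝ) (z : ℂ) : Prop :=
  IsConjRoot ℚ (a : ℂ) z ∨ IsConjRoot ℚ ((b⁻¹ : ℝ) : ℂ) z

/-- A (strict) conjugate pinching pair: the conjugates of `a` and `b⁻¹`, other than `a` and `b⁻¹`
themselves (which lie on the boundary circles), are in the open annulus `b⁻¹ < |z| < a`. -/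
structure IsConjugatePinchingPair (a b : ℝ) : Prop where
  pos_left : 0 < a
  pos_right : 0 < b
  unit_left : IsAlgebraicUnit a
  unit_right : IsAlgebraicUnit b⁻¹
  radius_le : b⁻¹ ≤ a
  conj_mem : ∀ z : ℂ, IsConjOfPair a b z → z ≠ (a : ℂ) → z ≠ ((b⁻¹ : ℝ) : ℂ) →
    b⁻¹ < ‖z‖ ∧ ‖z‖ < a

/-- A weak conjugate pinching pair: all conjugates of `a` and `b⁻¹` are in the closed annulus
`b⁻¹ ≤ |z| ≤ a`. -/
structure IsWeakConjugatePinchingPair (a b : ℝ) : Prop where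
  pos_left : 0 < a
  pos_right : 0 < b
  unit_left : IsAlgebraicUnit a
  unit_right : IsAlgebraicUnit b⁻¹
  conj_mem : ∀ z : ℂ, IsConjOfPair a b z → b⁻¹ ≤ ‖z‖ ∧ ‖z‖ ≤ a

/-- Every conjugate of `a` or `b⁻¹` that has modulus `a` or `b⁻¹` is `a` or `b⁻¹` times a root of
unity. -/
def ExtremalConjugatesAreRootMultiples (a b : ℝ) : Prop :=
  ∀ z : ℂ, IsConjOfPair a b z → (‖z‖ = a ∨ ‖z‖ = b⁻¹) →
    ∃ ζ : ℂ, (∃ k : ℕ, 0 < k ∧ ζ ^ k = 1) ∧ (z = (a : ℂ) * ζ ∨ z = ((b⁻¹ : ℝ) : ℂ) * ζ)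

end

/-! Necessity is Perron–Frobenius theory for two non-negative matrices, `A` and the sign-conjugate
of `A⁻¹`. All conjugates of `a` and `b⁻¹` are eigenvalues of `A`, so dominance of `a` and `b` puts
them in the closed annulus. An eigenvalue of maximal modulus of a non-negative matrix, irreducible
or not, is the spectral radius times a root of unity (`exists_pow_eq_of_growthLE`).

For sufficiency, strict pairs are a special case of weak pairs with the extremal condition. If `a ≤
1` or `b ≤ 1`, the product of the conjugates of a unit forces `a = b = 1`. Otherwise pass to `α = a
^ N` and `δ = b⁻¹ ^ N`, where `N` kills the roots of unity; then `α` and `δ` strictly pinch their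
other conjugates, the roots of a separable `f`. In the lattice `ℤ[X]/(f)`, the element `X⁻ʲ(Xᵐ -
1)(X - 1)w` is, for large `m` and a suitable `j`, large and of comparable size at `α` and `δ`, and
relatively small at the other roots. It therefore splits into a sum of elements of a finite set `F`
of lattice points, positive at `α` and `δ`, that does not depend on `w`. Applied to every `w` in
`F`, this gives a closed system of relations (`exists_orbit_relations`).

The values `tⁱw` and `tⁱ(tᴺ - 1)w`, with `i < N * m` and `w` evaluated at `tᴺ`, then form left
eigenvectors, at `t = a` and `t = b⁻¹`, of a product of unitriangular block matrices and a
permutation (`isBipositiveEigenvaluePair_of_orbits`). The factor `tᴺ - 1` is positive at `a` and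
negative at `b⁻¹`, which is the sign pattern of the partition. Left eigenvectors of these signs
certify both positive eigenvalues. -/

open Matrix Filter Topology
open scoped ComplexOrder

/-! ### Peripheral eigenvalues of non-negative matrices. -/

section PerronFrobenius

variable {ι : Type*} [Fintype ι] [DecidableEq ι]

theorem aeval_charpoly_eq_zero_iff_exists_mulVec (A : Matrix ι ι ℝ) (μ : ℂ) :
    Polynomial.aeval μ A.charpoly = 0 ↔
      ∃ x : ι → ℂ, x ≠ 0 ∧ A.map (algebraMap ℝ ℂ) *ᵥ x = μ • x := by
  rw [Polynomial.aeval_def, ← Polynomial.eval_map, ← Matrix.charpoly_map, Matrix.eval_charpoly,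
    ← Matrix.exists_mulVec_eq_zero_iff]
  refine exists_congr fun x => and_congr_right fun _ => ?_
  rw [Matrix.sub_mulVec, sub_eq_zero, Matrix.scalar_apply, ← Matrix.smul_one_eq_diagonal,
    Matrix.smul_mulVec, Matrix.one_mulVec, eq_comm]

omit [DecidableEq ι] in
theorem norm_mul_norm_le_mulVec_norm {A : Matrix ι ι ℝ} (hA : ∀ i j, 0 ≤ A i j) {x : ι → ℂ}
    {μ : ℂ} (hx : A.map (algebraMap ℝ ℂ) *ᵥ x = μ • x) (i : ι) :
    ‖μ‖ * ‖x i‖ ≤ (A *ᵥ fun j => ‖x j‖) i := by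
  have h := congrFun hx i
  simp only [Matrix.mulVec, dotProduct, Matrix.map_apply, Pi.smul_apply, smul_eq_mul] at h
  rw [← norm_mul, ← h]
  refine (norm_sum_le _ _).trans (le_of_eq ?_)
  simp only [Matrix.mulVec, dotProduct]
  refine Finset.sum_congr rfl fun j _ => ?_
  rw [norm_mul]
  simp [abs_of_nonneg (hA i j)]

/-- The powers of `A` grow at most like `a ^ k`, up to subexponential factors. -/
def GrowthLE (A : Matrix ι ι ℝ) (a : ℝ) : Prop :=
  ∀ b, a < b → ∃ C, ∀ k i j, (A ^ k) i j ≤ C * b ^ k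

/-- Gelfand's formula. Entrywise growth is the convenient form of the spectral bound because it
passes to transposes and, for non-negative matrices, to principal submatrices. -/
theorem growthLE_of_eigenvalues {A : Matrix ι ι ℝ} {a : ℝ} (ha : 0 < a)
    (h : ∀ μ : ℂ, Polynomial.aeval μ A.charpoly = 0 → ‖μ‖ ≤ a) : GrowthLE A a := by
  intro b hb
  let _ : NormedRing (Matrix ι ι ℂ) := Matrix.linftyOpNormedRing
  let _ : NormedAlgebra ℂ (Matrix ι ι ℂ) := Matrix.linftyOpNormedAlgebra
  set B : Matrix ι ι ℂ := A.map (algebraMap ℝ ℂ) with hB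
  have hρ : spectralRadius ℂ B ≤ ENNReal.ofReal a := by
    refine iSup₂_le fun μ hμ => ?_
    rw [Matrix.mem_spectrum_iff_isRoot_charpoly, hB, Matrix.charpoly_map] at hμ
    have := h μ (by rwa [Polynomial.IsRoot, Polynomial.eval_map, ← Polynomial.aeval_def] at hμ)
    rw [← ENNReal.ofReal_coe_nnreal, coe_nnnorm]
    exact ENNReal.ofReal_le_ofReal this
  have hlt : spectralRadius ℂ B < ENNReal.ofReal b :=
    hρ.trans_lt ((ENNReal.ofReal_lt_ofReal_iff (ha.trans hb)).2 hb)
  have hev := (spectrum.pow_norm_pow_one_div_tendsto_nhds_spectralRadius B).eventually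
    (gt_mem_nhds hlt)
  have hev' : ∀ᶠ k : ℕ in atTop, ‖B ^ k‖ ≤ b ^ k := by
    filter_upwards [hev, eventually_gt_atTop 0] with k hk hk0
    have h1 := (ENNReal.ofReal_lt_ofReal_iff (ha.trans hb)).1 hk
    have h2 := pow_le_pow_left₀ (Real.rpow_nonneg (norm_nonneg _) _) h1.le k
    rwa [← Real.rpow_natCast, ← Real.rpow_mul (norm_nonneg _), one_div,
      inv_mul_cancel₀ (by exact_mod_cast hk0.ne'), Real.rpow_one] at h2
  obtain ⟨K, hK⟩ := eventually_atTop.1 hev'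
  have hb0 := ha.trans hb
  have hent : ∀ k i j, (A ^ k) i j ≤ ‖B ^ k‖ := by
    intro k i j
    have : B ^ k = (A ^ k).map (algebraMap ℝ ℂ) := by
      rw [hB]; exact (Matrix.map_pow A (algebraMap ℝ ℂ) k).symm
    have h3 : ‖(B ^ k) i j‖ ≤ ‖B ^ k‖ := by
      rw [Matrix.linfty_opNorm_def]
      refine le_trans ?_ (NNReal.coe_le_coe.2 (Finset.le_sup (Finset.mem_univ i)))
      push_cast
      exact Finset.single_le_sum (f := fun j => ‖(B ^ k) i j‖) (fun _ _ => norm_nonneg _)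
        (Finset.mem_univ j)
    refine le_trans ?_ h3
    rw [this, Matrix.map_apply, norm_algebraMap', Real.norm_eq_abs]
    exact le_abs_self _
  refine ⟨1 + ∑ k ∈ Finset.range K, ‖B ^ k‖ / b ^ k, fun k i j => (hent k i j).trans ?_⟩
  have hs : 0 ≤ ∑ k ∈ Finset.range K, ‖B ^ k‖ / b ^ k :=
    Finset.sum_nonneg fun _ _ => by positivity
  by_cases hk : K ≤ k
  · refine (hK k hk).trans ?_
    nlinarith [pow_pos hb0 k]
  · have := Finset.single_le_sum (f := fun k => ‖B ^ k‖ / b ^ k) (fun _ _ => by positivity)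
      (Finset.mem_range.2 (not_le.1 hk))
    rw [← div_le_iff₀ (by positivity)]
    linarith

theorem pow_nonneg_entries {A : Matrix ι ι ℝ} (hA : ∀ i j, 0 ≤ A i j) (k : ℕ) (i j : ι) :
    0 ≤ (A ^ k) i j := by
  induction k generalizing i j with
  | zero => simp only [pow_zero, Matrix.one_apply]; split_ifs <;> norm_num
  | succ k ih =>
    rw [pow_succ, Matrix.mul_apply]
    exact Finset.sum_nonneg fun l _ => mul_nonneg (ih i l) (hA l j)

theorem GrowthLE.transpose {A : Matrix ι ι ℝ} {a : ℝ} (h : GrowthLE A a) : GrowthLE Aᵀ a := by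
  intro b hb
  obtain ⟨C, hC⟩ := h b hb
  refine ⟨C, fun k i j => ?_⟩
  rw [← Matrix.transpose_pow]
  exact hC k j i

theorem GrowthLE.submatrix {A : Matrix ι ι ℝ} (hA : ∀ i j, 0 ≤ A i j) {a : ℝ} (h : GrowthLE A a)
    (p : ι → Prop) [DecidablePred p] :
    GrowthLE (A.submatrix (Subtype.val : {i // p i} → ι) Subtype.val) a := by
  intro b hb
  obtain ⟨C, hC⟩ := h b hb
  refine ⟨C, fun k i j => le_trans ?_ (hC k i j)⟩
  induction k generalizing i j with
  | zero => simp [Matrix.one_apply, Subtype.ext_iff]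
  | succ k ih =>
    rw [pow_succ, pow_succ, Matrix.mul_apply, Matrix.mul_apply]
    calc _ ≤ ∑ l : {i // p i}, (A ^ k) i l * A l j :=
          Finset.sum_le_sum fun l _ => mul_le_mul_of_nonneg_right (ih i l) (hA _ _)
      _ ≤ _ := by
          rw [← Finset.sum_subtype (Finset.univ.filter p) (by simp)
            (fun l => (A ^ k) i l * A l j)]
          refine Finset.sum_le_sum_of_subset_of_nonneg (Finset.subset_univ _) fun l _ _ =>
            mul_nonneg (pow_nonneg_entries hA _ _ _) (hA _ _)

omit [DecidableEq ι] in
theorem mulVec_mono {A : Matrix ι ι ℝ} (hA : ∀ i j, 0 ≤ A i j) {x y : ι → ℝ} (h : x ≤ y) :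
    A *ᵥ x ≤ A *ᵥ y :=
  fun i => Finset.sum_le_sum fun j _ => mul_le_mul_of_nonneg_left (h j) (hA i j)

/-- A non-negative matrix of growth at most `a` that has a subinvariant vector has a non-negative
eigenvector for the eigenvalue `a`. -/
theorem exists_nonneg_eigenvector {A : Matrix ι ι ℝ} (hA : ∀ i j, 0 ≤ A i j) {a : ℝ} (ha : 0 < a)
    (hG : GrowthLE A a) {y : ι → ℝ} (hy : 0 ≤ y) (hy0 : y ≠ 0) (hAy : a • y ≤ A *ᵥ y) :
    ∃ r : ι → ℝ, 0 ≤ r ∧ r ≠ 0 ∧ A *ᵥ r = a • r := by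
  set s : ℕ → ℝ := fun k => ∑ i, ((A ^ k) *ᵥ y) i with hs
  have hsub : ∀ k, a • ((A ^ k) *ᵥ y) ≤ A *ᵥ ((A ^ k) *ᵥ y) := by
    intro k
    have h1 := mulVec_mono (pow_nonneg_entries hA k) hAy
    rwa [Matrix.mulVec_smul, Matrix.mulVec_mulVec, ← pow_succ, pow_succ',
      ← Matrix.mulVec_mulVec] at h1
  have hnn : ∀ k, 0 ≤ (A ^ k) *ᵥ y := fun k i =>
    Finset.sum_nonneg fun j _ => mul_nonneg (pow_nonneg_entries hA k i j) (hy j)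
  have hsucc : ∀ k, s (k + 1) = ∑ i, (A *ᵥ ((A ^ k) *ᵥ y)) i := by
    intro k; simp only [hs, pow_succ', Matrix.mulVec_mulVec]
  have hs0 : 0 < s 0 := by
    obtain ⟨i, hi⟩ := Function.ne_iff.1 hy0
    simp only [hs, pow_zero, Matrix.one_mulVec]
    exact Finset.sum_pos' (fun i _ => hy i) ⟨i, Finset.mem_univ i, lt_of_le_of_ne (hy i) (Ne.symm hi)⟩
  have hspos : ∀ k, 0 < s k := by
    intro k
    induction k with
    | zero => exact hs0
    | succ k ih =>
      rw [hsucc]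
      refine lt_of_lt_of_le (mul_pos ha ih) ?_
      rw [hs, Finset.mul_sum]
      exact Finset.sum_le_sum fun i _ => hsub k i
  -- If the total mass `s` grew by more than `a + ε` at every step, it would outgrow the bound from
  -- `GrowthLE` at rate `a + ε / 2`.
  have hclaim : ∀ ε > 0, ∃ k, s (k + 1) ≤ (a + ε) * s k := by
    intro ε hε
    by_contra! hcon
    have hgrow : ∀ k, (a + ε) ^ k * s 0 ≤ s k := by
      intro k
      induction k with
      | zero => simp
      | succ k ih =>
        refine le_trans ?_ (hcon k).le
        rw [pow_succ', mul_assoc]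
        exact mul_le_mul_of_nonneg_left ih (by positivity)
    obtain ⟨C, hC⟩ := hG (a + ε / 2) (by linarith)
    have hup : ∀ k, s k ≤ (∑ _i : ι, ∑ j, C * y j) * (a + ε / 2) ^ k := by
      intro k
      rw [Finset.sum_mul]
      refine Finset.sum_le_sum fun i _ => ?_
      rw [Finset.sum_mul]
      refine Finset.sum_le_sum fun j _ => ?_
      calc (A ^ k) i j * y j ≤ (C * (a + ε / 2) ^ k) * y j :=
            mul_le_mul_of_nonneg_right (hC k i j) (hy j)
        _ = _ := by ring
    have hlt : 1 < (a + ε) / (a + ε / 2) := by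
      rw [one_lt_div (by positivity)]; linarith
    obtain ⟨k, hk⟩ := ((tendsto_pow_atTop_atTop_of_one_lt hlt).eventually_gt_atTop
      ((∑ _i : ι, ∑ j, C * y j) / s 0)).exists
    have h1 := (hgrow k).trans (hup k)
    rw [div_pow, div_lt_div_iff₀ hs0 (by positivity)] at hk
    linarith
  -- The normalised iterates are almost invariant. Nested compact subsets of the simplex yield a
  -- limit `r` with `a • r ≤ A *ᵥ r` and total mass of `A *ᵥ r` at most `a`, which forces equality
  -- in every coordinate.
  set E : ℕ → Set (ι → ℝ) := fun n => {r | a • r ≤ A *ᵥ r} ∩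
    {r | ∑ i, (A *ᵥ r) i ≤ a + 1 / (n + 1)} with hE
  set D : ℕ → Set (ι → ℝ) := fun n => stdSimplex ℝ ι ∩ E n with hD
  have hclosed : ∀ n, IsClosed (E n) := by
    intro n
    have hc : Continuous fun r : ι → ℝ => A *ᵥ r := by fun_prop
    refine (isClosed_le (by fun_prop) hc).inter (isClosed_le ?_ continuous_const)
    exact continuous_finsetSum _ fun i _ => (continuous_apply i).comp hc
  have hne : (⋂ n, D n).Nonempty := by
    refine IsCompact.nonempty_iInter_of_sequence_nonempty_isCompact_isClosed D ?_ ?_ ?_ ?_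
    · rintro n r ⟨h1, h2, h3⟩
      refine ⟨h1, h2, le_trans (b := a + 1 / (((n + 1 : ℕ) : ℝ) + 1)) h3 ?_⟩
      have : (1 : ℝ) / ((n + 1 : ℕ) + 1) ≤ 1 / (n + 1) := by
        apply one_div_le_one_div_of_le <;> push_cast <;> linarith [(Nat.cast_nonneg n : (0:ℝ) ≤ n)]
      linarith
    · intro n
      obtain ⟨k, hk⟩ := hclaim (1 / ((n : ℝ) + 1)) (by positivity)
      refine ⟨(s k)⁻¹ • ((A ^ k) *ᵥ y), ⟨fun i => ?_, ?_⟩, ?_, ?_⟩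
      · exact mul_nonneg (inv_nonneg.2 (hspos k).le) (hnn k i)
      · simp only [Pi.smul_apply, smul_eq_mul, ← Finset.mul_sum]
        exact inv_mul_cancel₀ (hspos k).ne'
      · change a • _ ≤ A *ᵥ _
        rw [Matrix.mulVec_smul, smul_comm]
        exact smul_le_smul_of_nonneg_left (hsub k) (inv_nonneg.2 (hspos k).le)
      · change ∑ i, (A *ᵥ _) i ≤ _
        rw [Matrix.mulVec_smul]
        simp only [Pi.smul_apply, smul_eq_mul, ← Finset.mul_sum]
        rw [← hsucc, inv_mul_le_iff₀ (hspos k)]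
        linarith
    · exact (isCompact_stdSimplex ℝ ι).inter_right (hclosed 0)
    · exact fun n => (isClosed_stdSimplex ℝ ι).inter (hclosed n)
  obtain ⟨r, hr⟩ := hne
  rw [Set.mem_iInter] at hr
  obtain ⟨⟨hr0, hr1⟩, hr2, -⟩ := hr 0
  refine ⟨r, hr0, ?_, ?_⟩
  · rintro rfl
    simp at hr1
  · have hle : ∑ i, (A *ᵥ r) i ≤ ∑ i, (a • r) i := by
      simp only [Pi.smul_apply, smul_eq_mul, ← Finset.mul_sum, hr1, mul_one]
      refine le_of_forall_pos_le_add fun ε hε => ?_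
      obtain ⟨n, hn⟩ := exists_nat_one_div_lt hε
      have hn' : ∑ i, (A *ᵥ r) i ≤ a + 1 / (n + 1) := (hr n).2.2
      linarith
    have heq := (Finset.sum_eq_sum_iff_of_le fun i _ => hr2 i).1
      (le_antisymm (Finset.sum_le_sum fun i _ => hr2 i) hle)
    exact funext fun i => (heq i (Finset.mem_univ i)).symm

/-- Equality case of the triangle inequality: after rotation by `u⁻¹`, each term has real part equal
to its modulus. -/
theorem eq_norm_mul_of_norm_sum_eq {κ : Type*} (s : Finset κ) (v : κ → ℂ) {u : ℂ} {c : ℝ}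
    (hu : ‖u‖ = 1) (hsum : ∑ j ∈ s, v j = c * u) (hnorm : ∑ j ∈ s, ‖v j‖ = c) {j : κ}
    (hj : j ∈ s) : v j = ‖v j‖ * u := by
  have hu0 : u ≠ 0 := by rintro rfl; simp at hu
  have hle : ∀ j ∈ s, (v j * u⁻¹).re ≤ ‖v j‖ := fun j _ =>
    (Complex.re_le_norm _).trans (by rw [norm_mul, norm_inv, hu]; simp)
  have hs : ∑ j ∈ s, (v j * u⁻¹).re = ∑ j ∈ s, ‖v j‖ := by
    rw [← Complex.re_sum, ← Finset.sum_mul, hsum, mul_assoc, mul_inv_cancel₀ hu0, hnorm]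
    simp
  have h1 := (Finset.sum_eq_sum_iff_of_le hle).1 hs j hj
  have h2 : ‖v j * u⁻¹‖ = ‖v j‖ := by rw [norm_mul, norm_inv, hu]; simp
  have h3 : v j * u⁻¹ = ((‖v j‖ : ℝ) : ℂ) := by
    have h0 : (0 : ℂ) ≤ v j * u⁻¹ := Complex.re_eq_norm.1 (by rw [h1, h2])
    rw [← h2]
    exact Complex.eq_coe_norm_of_nonneg h0
  rw [← h3, mul_assoc, inv_mul_cancel₀ hu0, mul_one]

omit [DecidableEq ι] in
/-- An eigenvalue of maximal modulus of a non-negative matrix, whose eigenvector does not vanish on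
the support of a non-negative left eigenvector, is a multiple of the spectral radius by a root of
unity. -/
theorem exists_pow_eq_of_left_eigenvector {A : Matrix ι ι ℝ} (hA : ∀ i j, 0 ≤ A i j) {a : ℝ}
    (ha : 0 < a) {r : ι → ℝ} (hr : 0 ≤ r) (hrA : r ᵥ* A = a • r) {x : ι → ℂ} {μ : ℂ}
    (hx : A.map (algebraMap ℝ ℂ) *ᵥ x = μ • x) (hμ : ‖μ‖ = a) (hne : ∃ i, r i ≠ 0 ∧ x i ≠ 0) :
    ∃ k : ℕ, 0 < k ∧ μ ^ k = (a : ℂ) ^ k := by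
  have hle := norm_mul_norm_le_mulVec_norm hA hx
  rw [hμ] at hle
  -- Pairing with the left eigenvector `r` turns subinvariance of `‖x‖` into equality on the support
  -- of `r`.
  have hsum : ∑ i, r i * (a * ‖x i‖) = ∑ i, r i * (A *ᵥ fun j => ‖x j‖) i := by
    have h1 : r ⬝ᵥ (A *ᵥ fun j => ‖x j‖) = (a • r) ⬝ᵥ fun j => ‖x j‖ := by
      rw [Matrix.dotProduct_mulVec, hrA]
    rw [dotProduct, dotProduct] at h1
    rw [h1]
    exact Finset.sum_congr rfl fun i _ => by simp only [Pi.smul_apply, smul_eq_mul]; ring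
  have heq := (Finset.sum_eq_sum_iff_of_le fun i _ =>
    mul_le_mul_of_nonneg_left (hle i) (hr i)).1 hsum
  have hμ0 : μ ≠ 0 := by rintro rfl; rw [norm_zero] at hμ; exact ha.ne hμ
  have hac : (a : ℂ) ≠ 0 := by exact_mod_cast ha.ne'
  let S := {i // r i ≠ 0 ∧ x i ≠ 0}
  -- Equality in the triangle inequality aligns the phases: along an edge `A i j ≠ 0` with `x j ≠ 0`
  -- the phase of `x` is multiplied by `μ / a`. Such edges stay in the support of `r`, since `a * r
  -- j` is at least `r i * A i j`.
  have step : ∀ i : S, ∃ j : S, x j / ‖x j‖ = μ / a * (x i / ‖x i‖) := by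
    rintro ⟨i, hri, hxi⟩
    have hxin : (‖x i‖ : ℂ) ≠ 0 := by exact_mod_cast norm_ne_zero_iff.2 hxi
    have hi := mul_left_cancel₀ hri (heq i (Finset.mem_univ i))
    have hxe := congrFun hx i
    simp only [Matrix.mulVec, dotProduct, Matrix.map_apply, Pi.smul_apply, smul_eq_mul] at hi hxe
    have hex : ∃ j, A i j ≠ 0 ∧ x j ≠ 0 := by
      by_contra! hcon
      have : μ * x i = 0 := by
        rw [← hxe]
        refine Finset.sum_eq_zero fun j _ => ?_
        by_cases h : A i j = 0
        · simp [h]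
        · simp [hcon j h]
      exact mul_ne_zero hμ0 hxi this
    obtain ⟨j, hAj, hxj⟩ := hex
    have hxjn : (‖x j‖ : ℂ) ≠ 0 := by exact_mod_cast norm_ne_zero_iff.2 hxj
    have hrj : r j ≠ 0 := by
      intro h0
      have h1 := congrFun hrA j
      simp only [Matrix.vecMul, dotProduct, Pi.smul_apply, smul_eq_mul, h0, mul_zero] at h1
      have h2 := (Finset.sum_eq_zero_iff_of_nonneg fun k _ => mul_nonneg (hr k) (hA k j)).1 h1 i
        (Finset.mem_univ i)
      exact mul_ne_zero hri hAj h2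
    refine ⟨⟨j, hrj, hxj⟩, ?_⟩
    have hn : ∀ j, ‖algebraMap ℝ ℂ (A i j) * x j‖ = A i j * ‖x j‖ := fun j => by
      rw [norm_mul, norm_algebraMap', Real.norm_eq_abs, abs_of_nonneg (hA i j)]
    have key := eq_norm_mul_of_norm_sum_eq Finset.univ (fun j => algebraMap ℝ ℂ (A i j) * x j)
      (u := μ / a * (x i / ‖x i‖)) (c := a * ‖x i‖) ?_ ?_ ?_ (Finset.mem_univ j)
    · rw [hn] at key
      have hAc : ((A i j : ℝ) : ℂ) ≠ 0 := by exact_mod_cast hAj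
      simp only [Complex.coe_algebraMap, Complex.ofReal_mul, mul_assoc] at key
      rw [div_eq_iff hxjn, mul_left_cancel₀ hAc key, mul_comm (‖x j‖ : ℂ)]
      simp [abs_of_pos ha, hμ, ha.ne', hxi]
    · rw [norm_mul, norm_div, norm_div, hμ]
      simp [abs_of_pos ha, ha.ne', hxi]
    · rw [hxe]
      push_cast
      field_simp
    · rw [hi]
      exact Finset.sum_congr rfl fun j _ => hn j
  choose next hnext using step
  obtain ⟨i₀, hi₀⟩ := hne
  let p : ℕ → S := fun k => next^[k] ⟨i₀, hi₀⟩
  have hp : ∀ k, x (p k) / ‖x (p k)‖ = (μ / a) ^ k * (x i₀ / ‖x i₀‖) := by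
    intro k
    induction k with
    | zero => simp [p]
    | succ k ih =>
      have : p (k + 1) = next (p k) := Function.iterate_succ_apply' _ _ _
      rw [this, hnext, ih, pow_succ']
      ring
  -- A walk in the finite set `S` revisits a vertex, so a positive power of `μ / a` is 1.
  obtain ⟨m, n, hmn, hpe⟩ := Finite.exists_ne_map_eq_of_infinite p
  wlog hlt : m < n generalizing m n
  · exact this n m hmn.symm hpe.symm (lt_of_le_of_ne (not_lt.1 hlt) hmn.symm)
  refine ⟨n - m, Nat.sub_pos_of_lt hlt, ?_⟩
  have h0 : x i₀ / ‖x i₀‖ ≠ 0 :=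
    div_ne_zero hi₀.2 (by exact_mod_cast norm_ne_zero_iff.2 hi₀.2)
  have h1 : (μ / a) ^ m = (μ / a) ^ n := by
    have h2 := hp n
    rw [← hpe, hp m] at h2
    exact mul_right_cancel₀ h0 h2
  have h3 : (μ / a) ^ (n - m) = 1 := by
    have h4 : (μ / a) ^ m * (μ / a) ^ (n - m) = (μ / a) ^ m * 1 := by
      rw [← pow_add, Nat.add_sub_cancel' hlt.le, mul_one, h1]
    exact mul_left_cancel₀ (pow_ne_zero _ (div_ne_zero hμ0 hac)) h4
  rwa [div_pow, div_eq_one_iff_eq (pow_ne_zero _ hac)] at h3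

theorem exists_pow_eq_of_growthLE (n : ℕ) : ∀ (ι : Type*) [Fintype ι] [DecidableEq ι],
    Fintype.card ι = n → ∀ A : Matrix ι ι ℝ, (∀ i j, 0 ≤ A i j) → ∀ a : ℝ, 0 < a → GrowthLE A a →
    ∀ (x : ι → ℂ) (μ : ℂ), x ≠ 0 → A.map (algebraMap ℝ ℂ) *ᵥ x = μ • x → ‖μ‖ = a →
    ∃ k : ℕ, 0 < k ∧ μ ^ k = (a : ℂ) ^ k := by
  induction n using Nat.strong_induction_on with
  | _ n ih =>
  intro ι _ _ hn A hA a ha hG x μ hx0 hx hμ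
  obtain ⟨z, hz0, hz⟩ := (aeval_charpoly_eq_zero_iff_exists_mulVec Aᵀ μ).1 (by
    rw [Matrix.charpoly_transpose]
    exact (aeval_charpoly_eq_zero_iff_exists_mulVec A μ).2 ⟨x, hx0, hx⟩)
  have hA' : ∀ i j, 0 ≤ Aᵀ i j := fun i j => hA j i
  obtain ⟨r, hr, hr0, hrA⟩ := exists_nonneg_eigenvector hA' ha hG.transpose
    (y := fun j => ‖z j‖) (fun j => norm_nonneg _)
    (fun h => hz0 (funext fun j => norm_eq_zero.1 (congrFun h j)))
    (fun i => by have := norm_mul_norm_le_mulVec_norm hA' hz i; rwa [hμ] at this)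
  rw [Matrix.mulVec_transpose] at hrA
  by_cases hne : ∃ i, r i ≠ 0 ∧ x i ≠ 0
  · exact exists_pow_eq_of_left_eigenvector hA ha hr hrA hx hμ hne
  push Not at hne
  obtain ⟨i₀, hi₀⟩ := Function.ne_iff.1 hr0
  -- Here `x` lives on the zero set of `r`, which is smaller, and stays an eigenvector of that
  -- principal submatrix.
  refine ih (Fintype.card {i // r i = 0}) ?_ {i // r i = 0} rfl
    (A.submatrix Subtype.val Subtype.val) (fun i j => hA i j) a ha (hG.submatrix hA _)
    (fun i => x i) μ ?_ ?_ hμ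
  · rw [← hn]
    exact Fintype.card_subtype_lt hi₀
  · obtain ⟨j, hj⟩ := Function.ne_iff.1 hx0
    intro h
    exact hj (congrFun h ⟨j, by_contra fun h' => hj (hne j h')⟩)
  · ext i
    have h := congrFun hx i
    simp only [Matrix.mulVec, dotProduct, Matrix.map_apply, Pi.smul_apply, smul_eq_mul,
      Matrix.submatrix_apply] at h ⊢
    rw [← h]
    rw [← Finset.sum_subtype (Finset.univ.filter fun j => r j = 0) (by simp)
      (fun j => algebraMap ℝ ℂ (A i j) * x j)]
    refine Finset.sum_subset (Finset.subset_univ _) fun j _ hj => ?_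
    rw [hne j (by simpa using hj), mul_zero]

end PerronFrobenius

/-! ### Conjugation by the sign matrix of the partition. -/

section Flip

variable {ι : Type*}

open Classical in
/-- The sign attached to the index `i` when the basis vectors in `Q` are negated. -/
noncomputable def flipSign (Q : Set ι) (i : ι) : ℝ := if i ∈ Q then -1 else 1

theorem flipSign_mul_self (Q : Set ι) (i : ι) : flipSign Q i * flipSign Q i = 1 := by
  unfold flipSign; split_ifs <;> norm_num

theorem flipSign_ne_zero (Q : Set ι) (i : ι) : flipSign Q i ≠ 0 := by
  unfold flipSign; split_ifs <;> norm_num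

variable [Fintype ι] [DecidableEq ι]

theorem isNonnegWrt_basisFun_iff (M : Matrix ι ι ℝ) :
    IsNonnegWrt (Pi.basisFun ℝ ι) (Matrix.toLin' M) ↔ ∀ i j, 0 ≤ M i j := by
  rw [forall_comm]
  simp [IsNonnegWrt]

theorem flipBasis_basisFun_apply (Q : Set ι) (j : ι) :
    flipBasis (Pi.basisFun ℝ ι) Q j = flipSign Q j • Pi.single j 1 := by
  rw [flipBasis, Module.Basis.unitsSMul_apply, flipSign]
  split_ifs <;> simp

omit [DecidableEq ι] in
theorem flipBasis_basisFun_repr (Q : Set ι) (x : ι → ℝ) (i : ι) :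
    (flipBasis (Pi.basisFun ℝ ι) Q).repr x i = flipSign Q i * x i := by
  rw [flipBasis, Module.Basis.repr_unitsSMul, flipSign]
  split_ifs <;> simp

theorem isNonnegWrt_flipBasis_iff (Q : Set ι) (M : Matrix ι ι ℝ) :
    IsNonnegWrt (flipBasis (Pi.basisFun ℝ ι) Q) (Matrix.toLin' M) ↔
      ∀ i j, 0 ≤ flipSign Q i * M i j * flipSign Q j := by
  rw [forall_comm]
  refine forall_congr' fun j => forall_congr' fun i => ?_
  rw [flipBasis_basisFun_repr, flipBasis_basisFun_apply, map_smul]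
  simp [mul_assoc, mul_comm (M i j)]

/-- The conjugate of `M` by the diagonal matrix of the signs attached to `Q`. -/
noncomputable def flipMatrix (Q : Set ι) (M : Matrix ι ι ℝ) : Matrix ι ι ℝ :=
  Matrix.of fun i j => flipSign Q i * M i j * flipSign Q j

omit [DecidableEq ι] in
theorem flipMatrix_mulVec_iff (Q : Set ι) (M : Matrix ι ι ℝ) (x : ι → ℂ) (μ : ℂ) :
    (flipMatrix Q M).map (algebraMap ℝ ℂ) *ᵥ (fun i => flipSign Q i * x i) =
      μ • (fun i => (flipSign Q i : ℂ) * x i) ↔ M.map (algebraMap ℝ ℂ) *ᵥ x = μ • x := by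
  rw [funext_iff, funext_iff]
  refine forall_congr' fun i => ?_
  have h : ((flipMatrix Q M).map (algebraMap ℝ ℂ) *ᵥ (fun i => flipSign Q i * x i)) i =
      (flipSign Q i : ℂ) * (M.map (algebraMap ℝ ℂ) *ᵥ x) i := by
    simp only [Matrix.mulVec, dotProduct, Matrix.map_apply, flipMatrix, Matrix.of_apply,
      Finset.mul_sum]
    refine Finset.sum_congr rfl fun j _ => ?_
    have := congrArg (fun t : ℝ => (t : ℂ)) (flipSign_mul_self Q j)
    simp only [Complex.coe_algebraMap, Complex.ofReal_mul, Complex.ofReal_one] at this ⊢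
    linear_combination (flipSign Q i * M i j * x j : ℂ) * this
  have h0 : (flipSign Q i : ℂ) ≠ 0 := by exact_mod_cast flipSign_ne_zero Q i
  rw [h, Pi.smul_apply, Pi.smul_apply, smul_eq_mul, smul_eq_mul, mul_left_comm]
  exact mul_right_inj' h0

theorem aeval_charpoly_flipMatrix_eq_zero_iff (Q : Set ι) (M : Matrix ι ι ℝ) (μ : ℂ) :
    Polynomial.aeval μ (flipMatrix Q M).charpoly = 0 ↔ Polynomial.aeval μ M.charpoly = 0 := by
  have hne : ∀ x : ι → ℂ, x ≠ 0 → (fun i => (flipSign Q i : ℂ) * x i) ≠ 0 := by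
    intro x hx h
    refine hx (funext fun i => ?_)
    have h0 : (flipSign Q i : ℂ) ≠ 0 := by exact_mod_cast flipSign_ne_zero Q i
    exact (mul_eq_zero.1 (congrFun h i)).resolve_left h0
  rw [aeval_charpoly_eq_zero_iff_exists_mulVec, aeval_charpoly_eq_zero_iff_exists_mulVec]
  constructor
  · rintro ⟨x, hx0, hx⟩
    refine ⟨_, hne x hx0, (flipMatrix_mulVec_iff Q M _ μ).1 ?_⟩
    have h : (fun i => (flipSign Q i : ℂ) * ((flipSign Q i : ℂ) * x i)) = x := by
      funext i
      have := congrArg (fun t : ℝ => (t : ℂ)) (flipSign_mul_self Q i)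
      simp only [Complex.ofReal_mul, Complex.ofReal_one] at this
      rw [← mul_assoc, this, one_mul]
    rw [h, hx]
  · rintro ⟨x, hx0, hx⟩
    exact ⟨_, hne x hx0, (flipMatrix_mulVec_iff Q M x μ).2 hx⟩

end Flip

theorem aeval_eq_zero_of_isConjRoot {x z : ℂ} (h : IsConjRoot ℚ x z) {p : Polynomial ℤ}
    (hp : Polynomial.aeval x p = 0) : Polynomial.aeval z p = 0 := by
  rw [← Polynomial.aeval_map_algebraMap ℚ] at hp ⊢
  exact Polynomial.aeval_eq_zero_of_dvd_aeval_eq_zero (h ▸ minpoly.dvd ℚ x hp) (minpoly.aeval ℚ z)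

/-! ### Necessity of the pinching conditions. -/

section Forward

variable {n : ℕ}

theorem aeval_charpoly_map_intCast (A : Matrix (Fin n) (Fin n) ℤ) (z : ℂ) :
    Polynomial.aeval z (A.map (Int.castRingHom ℝ)).charpoly = Polynomial.aeval z A.charpoly := by
  rw [Matrix.charpoly_map]
  exact Polynomial.aeval_map_algebraMap ℝ z A.charpoly

theorem aeval_charpoly_eq_zero_of_mulVec_eq {A : Matrix (Fin n) (Fin n) ℤ} {v : Fin n → ℝ} (hv : v ≠ 0)
    {t : ℝ} (h : A.map (Int.castRingHom ℝ) *ᵥ v = t • v) :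
    Polynomial.aeval t A.charpoly = 0 := by
  rw [← Polynomial.aeval_map_algebraMap ℝ]
  change Polynomial.aeval t (A.charpoly.map (Int.castRingHom ℝ)) = 0
  rw [← Matrix.charpoly_map, Polynomial.coe_aeval_eq_eval, Matrix.eval_charpoly,
    ← Matrix.exists_mulVec_eq_zero_iff]
  refine ⟨v, hv, ?_⟩
  rw [Matrix.sub_mulVec, h, Matrix.scalar_apply, ← Matrix.smul_one_eq_diagonal,
    Matrix.smul_mulVec, Matrix.one_mulVec, sub_self]

theorem weak_and_extremal_of_isBipositiveEigenvaluePair {a b : ℝ}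
    (h : IsBipositiveEigenvaluePair a b) :
    IsWeakConjugatePinchingPair a b ∧ ExtremalConjugatesAreRootMultiples a b := by
  obtain ⟨n, A, P, Q, hbi, hpa, hpb⟩ := h
  set M : Matrix (Fin n) (Fin n) ℝ := (A : Matrix _ _ ℤ).map (Int.castRingHom ℝ) with hM
  set M' : Matrix (Fin n) (Fin n) ℝ :=
    ((A⁻¹ : GL (Fin n) ℤ) : Matrix _ _ ℤ).map (Int.castRingHom ℝ) with hM'
  have e1 : (realEquiv A).toLinearMap = Matrix.toLin' M := rfl
  have e2 : (realEquiv A).symm.toLinearMap = Matrix.toLin' M' := rfl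
  have hMM' : M * M' = 1 := by
    rw [hM, hM', ← Matrix.map_mul, ← Units.val_mul, mul_inv_cancel]
    simp
  have hM'M : M' * M = 1 := by
    rw [hM, hM', ← Matrix.map_mul, ← Units.val_mul, inv_mul_cancel]
    simp
  have hnn := hbi.nonneg
  have hnn' := hbi.nonneg_symm
  rw [e1, isNonnegWrt_basisFun_iff] at hnn
  rw [e2, isNonnegWrt_flipBasis_iff] at hnn'
  obtain ⟨ha, ⟨v, hv0, -, hv⟩, hda⟩ := hpa
  obtain ⟨hb, ⟨w, hw0, -, hw⟩, hdb⟩ := hpb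
  rw [e1, Matrix.toLin'_apply] at hv
  rw [e2, Matrix.toLin'_apply] at hw
  rw [e1, Matrix.charpoly_toLin'] at hda
  rw [e2, Matrix.charpoly_toLin'] at hdb
  have hinv : ∀ {x : Fin n → ℝ} {t : ℝ}, t ≠ 0 → ∀ {B C : Matrix (Fin n) (Fin n) ℝ}, C * B = 1 →
      B *ᵥ x = t • x → C *ᵥ x = t⁻¹ • x := by
    intro x t ht B C hCB hx
    have := congrArg (fun y => t⁻¹ • (C *ᵥ y)) hx
    simp only [Matrix.mulVec_mulVec, hCB, Matrix.one_mulVec, Matrix.mulVec_smul, smul_smul,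
      inv_mul_cancel₀ ht, one_smul] at this
    exact this.symm
  have hv' := hinv ha.ne' hM'M hv
  have hw' := hinv hb.ne' hMM' hw
  have int_of : ∀ {B : Matrix (Fin n) (Fin n) ℤ} {t : ℝ}, Polynomial.aeval t B.charpoly = 0 →
      IsIntegral ℤ t := fun {B t} h => ⟨B.charpoly, B.charpoly_monic, h⟩
  have key : ∀ z : ℂ, IsConjOfPair a b z → ∃ x : Fin n → ℂ, x ≠ 0 ∧
      M.map (algebraMap ℝ ℂ) *ᵥ x = z • x ∧ z ≠ 0 ∧ M'.map (algebraMap ℝ ℂ) *ᵥ x = z⁻¹ • x := by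
    intro z hz
    have hz0 : Polynomial.aeval z (A : Matrix (Fin n) (Fin n) ℤ).charpoly = 0 := by
      rcases hz with hz | hz
      · refine aeval_eq_zero_of_isConjRoot hz ?_
        rw [← Complex.coe_algebraMap, Polynomial.aeval_algebraMap_apply,
          aeval_charpoly_eq_zero_of_mulVec_eq hv0 hv, map_zero]
      · refine aeval_eq_zero_of_isConjRoot hz ?_
        rw [← Complex.coe_algebraMap, Polynomial.aeval_algebraMap_apply,
          aeval_charpoly_eq_zero_of_mulVec_eq hw0 hw', map_zero]
    rw [← aeval_charpoly_map_intCast, aeval_charpoly_eq_zero_iff_exists_mulVec] at hz0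
    obtain ⟨x, hx0, hx⟩ := hz0
    have hC : M'.map (algebraMap ℝ ℂ) * M.map (algebraMap ℝ ℂ) = 1 := by
      rw [← Matrix.map_mul, hM'M]; simp
    have h1 := congrArg (fun y => M'.map (algebraMap ℝ ℂ) *ᵥ y) hx
    simp only [Matrix.mulVec_mulVec, Matrix.mulVec_smul] at h1
    rw [show (A : Matrix (Fin n) (Fin n) ℤ).map (Int.castRingHom ℝ) = M from rfl, hC,
      Matrix.one_mulVec] at h1
    have hz0 : z ≠ 0 := by
      rintro rfl
      rw [zero_smul] at h1
      exact hx0 h1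
    refine ⟨x, hx0, hx, hz0, ?_⟩
    conv_rhs => rw [h1]
    rw [smul_smul, inv_mul_cancel₀ hz0, one_smul]
  refine ⟨⟨ha, hb, ⟨ha.ne', int_of (aeval_charpoly_eq_zero_of_mulVec_eq hv0 hv),
    int_of (aeval_charpoly_eq_zero_of_mulVec_eq hv0 hv')⟩, ⟨inv_ne_zero hb.ne',
    int_of (aeval_charpoly_eq_zero_of_mulVec_eq hw0 hw'), ?_⟩, fun z hz => ?_⟩, fun z hz hext => ?_⟩
  · rw [inv_inv]
    exact int_of (aeval_charpoly_eq_zero_of_mulVec_eq hw0 hw)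
  · obtain ⟨x, hx0, hx, hz0, hx'⟩ := key z hz
    refine ⟨?_, hda z ((aeval_charpoly_eq_zero_iff_exists_mulVec _ _).2 ⟨x, hx0, hx⟩)⟩
    have := hdb z⁻¹ ((aeval_charpoly_eq_zero_iff_exists_mulVec _ _).2 ⟨x, hx0, hx'⟩)
    rw [norm_inv] at this
    exact inv_le_of_inv_le₀ (norm_pos_iff.2 hz0) this
  · obtain ⟨x, hx0, hx, hz0, hx'⟩ := key z hz
    have hac : (a : ℂ) ≠ 0 := by exact_mod_cast ha.ne'
    have hbc : (b : ℂ) ≠ 0 := by exact_mod_cast hb.ne'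
    rcases hext with hext | hext
    · obtain ⟨k, hk, hzk⟩ := exists_pow_eq_of_growthLE n (Fin n) (Fintype.card_fin n) M hnn a ha
        (growthLE_of_eigenvalues ha hda) x z hx0 hx hext
      refine ⟨z / a, ⟨k, hk, ?_⟩, Or.inl (by field_simp)⟩
      rw [div_pow, hzk, div_self (pow_ne_zero _ hac)]
    -- On the inner circle `z⁻¹` has modulus `b`, so the peripheral statement applies to the
    -- non-negative sign-conjugate of the inverse.
    · have hne : (fun i => (flipSign Q i : ℂ) * x i) ≠ 0 := by
        intro h
        refine hx0 (funext fun i => ?_)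
        have h0 : (flipSign Q i : ℂ) ≠ 0 := by exact_mod_cast flipSign_ne_zero Q i
        exact (mul_eq_zero.1 (congrFun h i)).resolve_left h0
      obtain ⟨k, hk, hzk⟩ := exists_pow_eq_of_growthLE n (Fin n) (Fintype.card_fin n)
        (flipMatrix Q M') hnn' b hb
        (growthLE_of_eigenvalues hb fun μ hμ => hdb μ
          ((aeval_charpoly_flipMatrix_eq_zero_iff Q M' μ).1 hμ))
        (fun i => flipSign Q i * x i) z⁻¹ hne ((flipMatrix_mulVec_iff Q M' x z⁻¹).2 hx')
        (by rw [norm_inv, hext, inv_inv])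
      refine ⟨z * b, ⟨k, hk, ?_⟩, Or.inr ?_⟩
      · rw [mul_pow, ← hzk, ← mul_pow, mul_inv_cancel₀ hz0, one_pow]
      · push_cast
        field_simp

end Forward

/-! ### Left eigenvectors as certificates for positive eigenvalues. -/

section Criterion

variable {ι : Type*} [Fintype ι] [DecidableEq ι]

/-- A non-negative matrix with a positive left eigenvector has a non-negative right eigenvector for
the same eigenvalue. -/
theorem exists_right_eigenvector {M : Matrix ι ι ℝ} (hM : ∀ i j, 0 ≤ M i j) {r : ι → ℝ}
    (hr : ∀ i, 0 < r i) [Nonempty ι] {a : ℝ} (ha : 0 < a) (hrM : r ᵥ* M = a • r) :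
    ∃ v : ι → ℝ, v ≠ 0 ∧ (∀ i, 0 ≤ v i) ∧ M *ᵥ v = a • v := by
  have hz : Polynomial.aeval (a : ℂ) M.charpoly = 0 := by
    rw [← Matrix.charpoly_transpose, aeval_charpoly_eq_zero_iff_exists_mulVec]
    refine ⟨fun i => r i, ?_, ?_⟩
    · obtain ⟨i⟩ := ‹Nonempty ι›
      exact fun h => (hr i).ne' (Complex.ofReal_eq_zero.1 (congrFun h i))
    · funext i
      have h := congrArg (fun t : ℝ => (t : ℂ)) (congrFun hrM i)
      simp only [Matrix.vecMul, dotProduct, Pi.smul_apply, smul_eq_mul] at h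
      simp only [Matrix.mulVec, dotProduct, Pi.smul_apply, smul_eq_mul, Matrix.map_apply,
        Matrix.transpose_apply, Complex.coe_algebraMap]
      push_cast at h
      rw [← h]
      exact Finset.sum_congr rfl fun j _ => mul_comm _ _
  obtain ⟨x, hx0, hx⟩ := (aeval_charpoly_eq_zero_iff_exists_mulVec _ _).1 hz
  have hle := norm_mul_norm_le_mulVec_norm hM hx
  rw [Complex.norm_real, Real.norm_eq_abs, abs_of_pos ha] at hle
  refine ⟨fun i => ‖x i‖, fun h => hx0 (funext fun i => norm_eq_zero.1 (congrFun h i)),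
    fun i => norm_nonneg _, ?_⟩
  have hsum : ∑ i, r i * (a * ‖x i‖) = ∑ i, r i * (M *ᵥ fun j => ‖x j‖) i := by
    have h1 : r ⬝ᵥ (M *ᵥ fun j => ‖x j‖) = (a • r) ⬝ᵥ fun j => ‖x j‖ := by
      rw [Matrix.dotProduct_mulVec, hrM]
    rw [dotProduct, dotProduct] at h1
    rw [h1]
    exact Finset.sum_congr rfl fun i _ => by simp only [Pi.smul_apply, smul_eq_mul]; ring
  have heq := (Finset.sum_eq_sum_iff_of_le fun i _ =>
    mul_le_mul_of_nonneg_left (hle i) (hr i).le).1 hsum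
  exact funext fun i => (mul_left_cancel₀ (hr i).ne' (heq i (Finset.mem_univ i))).symm

/-- Pair `‖μ‖ * ‖x‖ ≤ M *ᵥ ‖x‖` with `r`; the pairing of `r` with `‖x‖` is positive because every
entry of `r` is. -/
theorem norm_le_of_left_eigenvector {M : Matrix ι ι ℝ} (hM : ∀ i j, 0 ≤ M i j) {r : ι → ℝ}
    (hr : ∀ i, 0 < r i) {a : ℝ} (hrM : r ᵥ* M = a • r) {μ : ℂ}
    (hμ : Polynomial.aeval μ M.charpoly = 0) : ‖μ‖ ≤ a := by
  obtain ⟨x, hx0, hx⟩ := (aeval_charpoly_eq_zero_iff_exists_mulVec _ _).1 hμ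
  have hle := norm_mul_norm_le_mulVec_norm hM hx
  have h1 : r ⬝ᵥ (M *ᵥ fun j => ‖x j‖) = a * (r ⬝ᵥ fun j => ‖x j‖) := by
    rw [Matrix.dotProduct_mulVec, hrM, smul_dotProduct, smul_eq_mul]
  have h2 : ‖μ‖ * (r ⬝ᵥ fun j => ‖x j‖) ≤ r ⬝ᵥ (M *ᵥ fun j => ‖x j‖) := by
    rw [dotProduct, Finset.mul_sum]
    refine Finset.sum_le_sum fun i _ => ?_
    have := mul_le_mul_of_nonneg_left (hle i) (hr i).le
    linarith
  have h3 : 0 < r ⬝ᵥ fun j => ‖x j‖ := by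
    obtain ⟨i, hi⟩ := Function.ne_iff.1 hx0
    exact Finset.sum_pos' (fun i _ => mul_nonneg (hr i).le (norm_nonneg _))
      ⟨i, Finset.mem_univ i, mul_pos (hr i) (norm_pos_iff.2 hi)⟩
  rw [h1] at h2
  exact le_of_mul_le_mul_right h2 h3

end Criterion

/-! ### From vector relations to bipositive matrices. -/

/-- A pair of mutually inverse integer matrices of the required sign pattern, with a positive left
eigenvector for `a` and a left eigenvector for `b⁻¹` of the required sign pattern, witnesses that
`(a, b)` is the eigenvalue pair of a bipositive matrix. -/
theorem isBipositiveEigenvaluePair_of_matrix {ι : Type*} [Fintype ι] [DecidableEq ι] [Nonempty ι]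
    {a b : ℝ} (ha : 0 < a) (hb : 0 < b) (Q : Set ι) (A B : Matrix ι ι ℤ) (hAB : A * B = 1)
    (hBA : B * A = 1) (hA : ∀ i j, 0 ≤ A i j)
    (hB : ∀ i j, 0 ≤ flipSign Q i * (B i j : ℝ) * flipSign Q j)
    (r l : ι → ℝ) (hr : ∀ i, 0 < r i) (hl : ∀ i, 0 < flipSign Q i * l i)
    (hrA : r ᵥ* A.map (Int.castRingHom ℝ) = a • r)
    (hlA : l ᵥ* A.map (Int.castRingHom ℝ) = b⁻¹ • l) : IsBipositiveEigenvaluePair a b := by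
  let e := Fintype.equivFin ι
  let A' : Matrix (Fin (Fintype.card ι)) (Fin (Fintype.card ι)) ℤ := Matrix.reindex e e A
  let B' : Matrix (Fin (Fintype.card ι)) (Fin (Fintype.card ι)) ℤ := Matrix.reindex e e B
  have hA'B' : A' * B' = 1 := by
    simp only [A', B', Matrix.reindex_apply]
    rw [Matrix.submatrix_mul_equiv, hAB, Matrix.submatrix_one_equiv]
  have hB'A' : B' * A' = 1 := by
    simp only [A', B', Matrix.reindex_apply]
    rw [Matrix.submatrix_mul_equiv, hBA, Matrix.submatrix_one_equiv]
  let G : GL (Fin (Fintype.card ι)) ℤ := ⟨A', B', hA'B', hB'A'⟩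
  let Q' : Set (Fin (Fintype.card ι)) := e.symm ⁻¹' Q
  have hsign : ∀ i, flipSign Q' i = flipSign Q (e.symm i) := fun i => rfl
  have : Nonempty (Fin (Fintype.card ι)) := ⟨e (Classical.arbitrary ι)⟩
  set M : Matrix (Fin (Fintype.card ι)) (Fin (Fintype.card ι)) ℝ := A'.map (Int.castRingHom ℝ)
    with hM
  set N : Matrix (Fin (Fintype.card ι)) (Fin (Fintype.card ι)) ℝ := B'.map (Int.castRingHom ℝ)
    with hN
  have e1 : (realEquiv G).toLinearMap = Matrix.toLin' M := rfl
  have e2 : (realEquiv G).symm.toLinearMap = Matrix.toLin' N := rfl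
  have hMN : M * N = 1 := by
    rw [hM, hN, ← Matrix.map_mul, hA'B']
    simp
  have hMnn : ∀ i j, 0 ≤ M i j := fun i j => by
    exact Int.cast_nonneg (hA _ _)
  have hNnn : ∀ i j, 0 ≤ flipMatrix Q' N i j := fun i j => hB (e.symm i) (e.symm j)
  have hvec : ∀ (t : ι → ℝ) (c : ℝ), t ᵥ* A.map (Int.castRingHom ℝ) = c • t →
      (t ∘ e.symm) ᵥ* M = c • (t ∘ e.symm) := by
    intro t c h
    funext i
    have h1 := congrFun h (e.symm i)
    simp only [Matrix.vecMul, dotProduct, Pi.smul_apply] at h1 ⊢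
    rw [Function.comp_apply, ← h1]
    exact e.symm.sum_comp (fun j => t j * A.map (Int.castRingHom ℝ) j (e.symm i))
  have hr' := hvec r a hrA
  have hl' : (fun i => flipSign Q' i * l (e.symm i)) ᵥ* flipMatrix Q' N =
      b • fun i => flipSign Q' i * l (e.symm i) := by
    have h1 : (l ∘ e.symm) ᵥ* N = b • (l ∘ e.symm) := by
      have h2 := congrArg (fun y => b • (y ᵥ* N)) (hvec l b⁻¹ hlA)
      simp only [Matrix.vecMul_vecMul, hMN, Matrix.vecMul_one, Matrix.smul_vecMul, smul_smul,
        mul_inv_cancel₀ hb.ne', one_smul] at h2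
      exact h2.symm
    funext i
    have h2 := congrFun h1 i
    simp only [Matrix.vecMul, dotProduct, Pi.smul_apply, smul_eq_mul, flipMatrix,
      Matrix.of_apply, Function.comp_apply] at h2 ⊢
    rw [mul_left_comm, ← h2, Finset.mul_sum]
    refine Finset.sum_congr rfl fun j _ => ?_
    linear_combination (l (e.symm j) * N j i * flipSign Q' i) * flipSign_mul_self Q' j
  have hlpos : ∀ i, 0 < flipSign Q' i * l (e.symm i) := fun i => hl _
  refine ⟨Fintype.card ι, G, Q'ᶜ, Q', ⟨isCompl_compl.symm, ?_, ?_⟩, ⟨ha, ?_, ?_⟩, ⟨hb, ?_, ?_⟩⟩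
  · rw [e1, isNonnegWrt_basisFun_iff]
    exact hMnn
  · rw [e2, isNonnegWrt_flipBasis_iff]
    exact hNnn
  · obtain ⟨v, hv0, hv1, hv2⟩ := exists_right_eigenvector hMnn (fun i => hr (e.symm i)) ha hr'
    exact ⟨v, hv0, fun i => hv1 i, hv2⟩
  · intro μ hμ
    rw [e1, Matrix.charpoly_toLin'] at hμ
    exact norm_le_of_left_eigenvector hMnn (fun i => hr (e.symm i)) hr' hμ
  · obtain ⟨v, hv0, hv1, hv2⟩ := exists_right_eigenvector hNnn hlpos hb hl'
    refine ⟨fun i => flipSign Q' i * v i, fun h => hv0 (funext fun i => ?_), fun i => ?_, ?_⟩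
    · exact (mul_eq_zero.1 (congrFun h i)).resolve_left (flipSign_ne_zero Q' i)
    · rw [flipBasis_basisFun_repr, ← mul_assoc, flipSign_mul_self, one_mul]
      exact hv1 i
    · rw [e2, Matrix.toLin'_apply]
      funext i
      have h2 := congrFun hv2 i
      simp only [Matrix.mulVec, dotProduct, Pi.smul_apply, smul_eq_mul, flipMatrix,
        Matrix.of_apply] at h2 ⊢
      rw [mul_left_comm, ← h2, Finset.mul_sum]
      refine Finset.sum_congr rfl fun j _ => ?_
      linear_combination (-(N i j * flipSign Q' j * v j)) * flipSign_mul_self Q' i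
  · intro μ hμ
    rw [e2, Matrix.charpoly_toLin', ← aeval_charpoly_flipMatrix_eq_zero_iff Q'] at hμ
    exact norm_le_of_left_eigenvector hNnn hlpos hl' hμ

/-- The criterion for a product of a lower unitriangular, an upper unitriangular and a permutation
block matrix. -/
theorem isBipositiveEigenvaluePair_of_blocks {X : Type*} [Fintype X] [DecidableEq X] [Nonempty X]
    {a b : ℝ} (ha : 0 < a) (hb : 0 < b) (σ : Equiv.Perm X) (U W : Matrix X X ℕ)
    (x y : X → ℝ) (hx : ∀ i, 0 < x i) (hy : ∀ i, 0 < y i)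
    (z w : X → ℝ) (hz : ∀ i, 0 < z i) (hw : ∀ i, w i < 0)
    (h1 : ∀ i, x (σ i) + ∑ j, y j * W j (σ i) = a * x i)
    (h2 : ∀ i, y (σ i) + ∑ j, (x j + ∑ k, y k * W k j) * U j (σ i) = a * y i)
    (h3 : ∀ i, z (σ i) + ∑ j, w j * W j (σ i) = b⁻¹ * z i)
    (h4 : ∀ i, w (σ i) + ∑ j, (z j + ∑ k, w k * W k j) * U j (σ i) = b⁻¹ * w i) :
    IsBipositiveEigenvaluePair a b := by
  let Uz : Matrix X X ℤ := U.map (Nat.cast)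
  let Wz : Matrix X X ℤ := W.map (Nat.cast)
  let τ : Equiv.Perm (X ⊕ X) := Equiv.sumCongr σ σ
  -- `L` is `(1 0; W 1) * (1 U; 0 1)` and `R` multiplies the inverse factors in reverse order.
  -- Negating the second block makes `R` non-negative, and the permutation respects the blocks.
  let L : Matrix (X ⊕ X) (X ⊕ X) ℤ := fromBlocks 1 Uz Wz (Wz * Uz + 1)
  let R : Matrix (X ⊕ X) (X ⊕ X) ℤ := fromBlocks (1 + Uz * Wz) (-Uz) (-Wz) 1
  have hLR : L * R = 1 := by
    simp only [L, R, fromBlocks_multiply]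
    rw [← fromBlocks_one]
    congr 1 <;> noncomm_ring
  have hRL : R * L = 1 := by
    simp only [L, R, fromBlocks_multiply]
    rw [← fromBlocks_one]
    congr 1 <;> noncomm_ring
  have hone : ∀ i j : X, (0 : ℤ) ≤ (1 : Matrix X X ℤ) i j := fun i j => by
    rw [Matrix.one_apply]; split_ifs <;> norm_num
  have hUz : ∀ i j, 0 ≤ Uz i j := fun i j => Int.natCast_nonneg _
  have hWz : ∀ i j, 0 ≤ Wz i j := fun i j => Int.natCast_nonneg _
  have hUW : ∀ i j, 0 ≤ (Uz * Wz) i j := fun i j =>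
    Finset.sum_nonneg fun k _ => mul_nonneg (hUz i k) (hWz k j)
  have hWU : ∀ i j, 0 ≤ (Wz * Uz) i j := fun i j =>
    Finset.sum_nonneg fun k _ => mul_nonneg (hWz i k) (hUz k j)
  have hsl : ∀ i : X, flipSign (Set.range (Sum.inr : X → X ⊕ X)) (Sum.inl i) = 1 := fun i => by
    simp [flipSign]
  have hsr : ∀ i : X, flipSign (Set.range (Sum.inr : X → X ⊕ X)) (Sum.inr i) = -1 := fun i => by
    simp [flipSign]
  have hRsign : ∀ i j, 0 ≤ flipSign (Set.range (Sum.inr : X → X ⊕ X)) i * (R i j : ℝ) *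
      flipSign (Set.range (Sum.inr : X → X ⊕ X)) j := by
    rintro (i | i) (j | j)
    · have : 0 ≤ R (Sum.inl i) (Sum.inl j) := add_nonneg (hone i j) (hUW i j)
      rw [hsl, hsl, one_mul, mul_one]
      exact Int.cast_nonneg this
    · have : R (Sum.inl i) (Sum.inr j) = -(U i j : ℤ) := rfl
      rw [hsl, hsr, this]
      simp
    · have : R (Sum.inr i) (Sum.inl j) = -(W i j : ℤ) := rfl
      rw [hsl, hsr, this]
      simp
    · have : 0 ≤ R (Sum.inr i) (Sum.inr j) := hone i j
      rw [hsr, hsr, neg_mul, one_mul, mul_neg, mul_one, neg_neg]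
      exact Int.cast_nonneg this
  have hvec : ∀ (c : ℝ) (p q : X → ℝ),
      (∀ i, p (σ i) + ∑ j, q j * W j (σ i) = c * p i) →
      (∀ i, q (σ i) + ∑ j, (p j + ∑ k, q k * W k j) * U j (σ i) = c * q i) →
      Sum.elim p q ᵥ* (L.submatrix id τ).map (Int.castRingHom ℝ) = c • Sum.elim p q := by
    intro c p q hp hq
    funext i
    rcases i with i | i
    · rw [Pi.smul_apply, Sum.elim_inl, smul_eq_mul, ← hp i]
      simp only [Matrix.vecMul, dotProduct, Fintype.sum_sum_type, Sum.elim_inl, Sum.elim_inr]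
      congr 1
      · simp [L, τ, Matrix.one_apply]
    · rw [Pi.smul_apply, Sum.elim_inr, smul_eq_mul, ← hq i]
      simp only [Matrix.vecMul, dotProduct, Fintype.sum_sum_type, Sum.elim_inl, Sum.elim_inr]
      simp only [L, τ, Uz, Wz, Matrix.map_apply, Matrix.submatrix_apply, id, Equiv.sumCongr_apply,
        Sum.map_inr, fromBlocks_apply₁₂, fromBlocks_apply₂₂, Matrix.add_apply, Matrix.mul_apply,
        map_add, map_sum, map_mul, mul_add, Finset.sum_add_distrib, add_mul, Finset.sum_mul,
        Finset.mul_sum]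
      rw [Finset.sum_comm (f := fun j k => q k * (W k j : ℝ) * (U j (σ i) : ℝ))]
      simp [Matrix.one_apply, mul_assoc]
      ring
  refine isBipositiveEigenvaluePair_of_matrix ha hb (Set.range Sum.inr) (L.submatrix id τ)
    (R.submatrix τ id) ?_ ?_ ?_ ?_ (Sum.elim x y) (Sum.elim z w) ?_ ?_ (hvec a x y h1 h2)
    (hvec b⁻¹ z w h3 h4)
  · rw [Matrix.submatrix_mul_equiv, hLR, Matrix.submatrix_id_id]
  · have := (Matrix.submatrix_mul_equiv R L τ (Equiv.refl _) τ).trans (by rw [hRL])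
    rw [Matrix.submatrix_one_equiv] at this
    exact this
  · rintro (i | i) (j | j)
    · exact hone _ _
    · exact hUz _ _
    · exact hWz _ _
    · exact add_nonneg (hWU _ _) (hone _ _)
  · intro i j
    have h : ∀ i, flipSign (Set.range (Sum.inr : X → X ⊕ X)) i =
        flipSign (Set.range (Sum.inr : X → X ⊕ X)) (τ i) := by
      rintro (i | i)
      · exact (hsl i).trans (hsl (σ i)).symm
      · exact (hsr i).trans (hsr (σ i)).symm
    rw [h i]
    exact hRsign (τ i) j
  · rintro (i | i)
    · exact hx i
    · exact hy i
  · rintro (i | i)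
    · rw [hsl, one_mul]
      exact hz i
    · rw [hsr, neg_one_mul]
      exact neg_pos.2 (hw i)

theorem sum_range_mul_dvd_pow {R : Type*} [CommRing R] (t : R) {N : ℕ} (hN : 0 < N) (m : ℕ) :
    ∑ i ∈ Finset.range (N * m), (if N ∣ i then t ^ i else 0) =
      ∑ l ∈ Finset.range m, (t ^ N) ^ l := by
  induction m with
  | zero => simp
  | succ m ih =>
    rw [Nat.mul_succ, Finset.sum_range_add, ih, Finset.sum_range_succ]
    congr 1
    rw [Finset.sum_eq_single_of_mem 0 (Finset.mem_range.2 hN)]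
    · simp [pow_mul]
    · intro i hi hi0
      rw [if_neg]
      rw [Nat.dvd_add_right (dvd_mul_right N m)]
      exact fun h => hi0 (Nat.eq_zero_of_dvd_of_lt h (Finset.mem_range.1 hi))

/-- If the vectors `ω s` satisfy the relations `(t ^ (N * m) - 1) (t ^ N - 1) ω s =
t ^ (N * j s) ∑ c s k ω k` in both eigendirections `t = a` and `t = b⁻¹`, then `(a, b)` is the
eigenvalue pair of the bipositive matrix which shifts the orbit segments of the `ω s` and of the
`(t ^ N - 1) ω s`. -/
theorem isBipositiveEigenvaluePair_of_orbits {S : Type*} [Fintype S] [DecidableEq S] [Nonempty S]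
    {a b : ℝ} (ha : 1 < a) (hb : 1 < b) {N m : ℕ} (hN : 0 < N) (j : S → ℕ) (hj0 : ∀ s, 0 < j s)
    (hjm : ∀ s, j s < m) (c : S → S → ℕ) (α β : S → ℝ) (hα : ∀ s, 0 < α s) (hβ : ∀ s, 0 < β s)
    (h1 : ∀ s, ((a ^ N) ^ m - 1) * (a ^ N - 1) * α s = (a ^ N) ^ j s * ∑ k, c s k * α k)
    (h2 : ∀ s, ((b⁻¹ ^ N) ^ m - 1) * (b⁻¹ ^ N - 1) * β s =
      (b⁻¹ ^ N) ^ j s * ∑ k, c s k * β k) :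
    IsBipositiveEigenvaluePair a b := by
  have ha0 : 0 < a := by linarith
  have hb0 : 0 < b := by linarith
  have hm : 0 < m := (hj0 (Classical.arbitrary S)).trans (hjm _)
  obtain ⟨M, hM⟩ : ∃ M, N * m = M + 1 := Nat.exists_eq_succ_of_ne_zero (Nat.mul_pos hN hm).ne'
  have hjM : ∀ s, N * j s < M + 1 := fun s => hM ▸ Nat.mul_lt_mul_of_pos_left (hjm s) hN
  let σ : Equiv.Perm (S × Fin (M + 1)) := Equiv.prodCongr (Equiv.refl S) (Equiv.addRight 1)
  -- Both matrices act only where an orbit segment wraps round to index 0: `W` completes `ω s` to `t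
  -- ^ (N * m) * ω s` by a telescoping sum, and `U` inserts the given relation for `(t ^ N - 1) * ω
  -- s`.
  let W : Matrix (S × Fin (M + 1)) (S × Fin (M + 1)) ℕ := fun p q =>
    if q.2 = 0 ∧ p.1 = q.1 ∧ N ∣ p.2.val then 1 else 0
  let U : Matrix (S × Fin (M + 1)) (S × Fin (M + 1)) ℕ := fun p q =>
    if q.2 = 0 ∧ p.2.val = N * j q.1 then c q.1 p.1 else 0
  have main : ∀ (t : ℝ) (ω : S → ℝ),
      (∀ s, ((t ^ N) ^ m - 1) * (t ^ N - 1) * ω s = (t ^ N) ^ j s * ∑ k, c s k * ω k) →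
      (∀ i : S × Fin (M + 1), t ^ (σ i).2.val * ω (σ i).1 +
        ∑ p : S × Fin (M + 1), t ^ p.2.val * ((t ^ N - 1) * ω p.1) * W p (σ i) =
          t * (t ^ i.2.val * ω i.1)) ∧
      (∀ i : S × Fin (M + 1), t ^ (σ i).2.val * ((t ^ N - 1) * ω (σ i).1) +
        ∑ p : S × Fin (M + 1), (t ^ p.2.val * ω p.1 +
          ∑ q : S × Fin (M + 1), t ^ q.2.val * ((t ^ N - 1) * ω q.1) * W q p) * U p (σ i) =
          t * (t ^ i.2.val * ((t ^ N - 1) * ω i.1))) := by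
    intro t ω h
    have hW : ∀ q : S × Fin (M + 1), t ^ q.2.val * ω q.1 +
        ∑ p : S × Fin (M + 1), t ^ p.2.val * ((t ^ N - 1) * ω p.1) * W p q =
          t ^ (if q.2 = 0 then M + 1 else q.2.val) * ω q.1 := by
      rintro ⟨s, i⟩
      by_cases hi : i = 0
      · subst hi
        have e : ∑ p : S × Fin (M + 1), t ^ p.2.val * ((t ^ N - 1) * ω p.1) * W p (s, 0) =
            (∑ i ∈ Finset.range (N * m), if N ∣ i then t ^ i else 0) * ((t ^ N - 1) * ω s) := by
          rw [hM, Finset.sum_range, Finset.sum_mul, Fintype.sum_prod_type,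
            Finset.sum_eq_single_of_mem s (Finset.mem_univ s)]
          · refine Finset.sum_congr rfl fun i _ => ?_
            simp only [W, true_and]
            split_ifs <;> simp
          · intro k _ hk
            exact Finset.sum_eq_zero fun i _ => by simp [W, hk]
        rw [e, sum_range_mul_dvd_pow t hN, ← mul_assoc, geom_sum_mul]
        simp only [if_true, ← hM, pow_mul, Fin.val_zero]
        ring
      · simp [W, hi]
    have hU : ∀ (x : S × Fin (M + 1) → ℝ) (s : S) (i : Fin (M + 1)),
        ∑ p, x p * U p (s, i) = if i = 0 then ∑ k, c s k * x (k, ⟨N * j s, hjM s⟩) else 0 := by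
      intro x s i
      by_cases hi : i = 0
      · simp only [U, hi, if_true, true_and]
        rw [Fintype.sum_prod_type]
        refine Finset.sum_congr rfl fun k _ => ?_
        rw [Finset.sum_eq_single_of_mem ⟨N * j s, hjM s⟩ (Finset.mem_univ _)]
        · simp [mul_comm]
        · intro l _ hl
          rw [if_neg fun h' => hl (Fin.ext h')]
          simp
      · simp [U, hi]
    have hσ : ∀ i : Fin (M + 1), (if i + 1 = 0 then M + 1 else (i + 1).val) = i.val + 1 := by
      intro i
      by_cases hi : i = Fin.last M
      · simp [hi]
      · rw [if_neg, Fin.val_add_one, if_neg hi]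
        intro h0
        apply hi
        have := congrArg (· + Fin.last M) h0
        simpa [add_assoc, add_comm (1 : Fin (M + 1))] using this
    refine ⟨?_, ?_⟩
    · rintro ⟨s, i⟩
      rw [hW]
      change t ^ (if i + 1 = 0 then M + 1 else (i + 1).val) * ω s = _
      rw [hσ]
      ring
    · rintro ⟨s, i⟩
      simp only [hW]
      rw [show σ (s, i) = (s, i + 1) from rfl, hU]
      dsimp only
      have hσi := hσ i
      by_cases hi : i + 1 = 0
      · rw [if_pos hi] at hσi ⊢
        -- Position 0 must be avoided: there the row already updated by `W` holds `t ^ (M + 1) * ω`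
        -- instead of `ω`. This is where `0 < j s` is needed.
        have hne : ∀ s, (⟨N * j s, hjM s⟩ : Fin (M + 1)) ≠ 0 := fun s h0 =>
          (Nat.mul_pos hN (hj0 s)).ne' (congrArg Fin.val h0)
        have hs := h s
        simp only [hne, if_false]
        simp only [← mul_assoc, ← pow_mul, hM, ← pow_succ'] at hs ⊢
        rw [← hσi, hi]
        rw [Finset.mul_sum] at hs
        have e : ∑ k, (c s k : ℝ) * t ^ (N * j s) * ω k = ∑ k, t ^ (N * j s) * (c s k * ω k) :=
          Finset.sum_congr rfl fun k _ => by ring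
        rw [e, ← hs]
        simp
        ring
      · rw [if_neg hi] at hσi ⊢
        rw [hσi]
        ring
  have hb1 : b⁻¹ < 1 := inv_lt_one_of_one_lt₀ hb
  have hbi : 0 < b⁻¹ := inv_pos.2 hb0
  obtain ⟨m1, m2⟩ := main a α h1
  obtain ⟨m3, m4⟩ := main b⁻¹ β h2
  refine isBipositiveEigenvaluePair_of_blocks ha0 hb0 σ U W
    (fun p => a ^ p.2.val * α p.1) (fun p => a ^ p.2.val * ((a ^ N - 1) * α p.1))
    (fun p => mul_pos (pow_pos ha0 _) (hα _))
    (fun p => mul_pos (pow_pos ha0 _) (mul_pos (sub_pos.2 (one_lt_pow₀ ha hN.ne')) (hα _)))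
    (fun p => b⁻¹ ^ p.2.val * β p.1) (fun p => b⁻¹ ^ p.2.val * ((b⁻¹ ^ N - 1) * β p.1))
    (fun p => mul_pos (pow_pos hbi _) (hβ _))
    (fun p => mul_neg_of_pos_of_neg (pow_pos hbi _)
      (mul_neg_of_neg_of_pos (sub_neg.2 (pow_lt_one₀ hbi.le hb1 hN.ne')) (hβ _)))
    m1 m2 m3 m4

/-! ### Lattice points of `ℤ[X]/(f)`: finiteness, splitting and balancing. -/

section PolynomialLattice

open Polynomial

/-- Makes `X` invertible modulo `f`, so that division by powers of a root stays within integer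
polynomials. -/
theorem exists_dvd_X_mul_sub_one {f : ℤ[X]} (hf : IsUnit (f.coeff 0)) : ∃ q : ℤ[X], f ∣ X * q - 1 := by
  obtain ⟨u, hu⟩ := hf
  refine ⟨-(C (↑u⁻¹ : ℤ) * f.divX), -C (↑u⁻¹ : ℤ), ?_⟩
  have h1 := Polynomial.X_mul_divX_add f
  have h2 : (C (↑u⁻¹ : ℤ) : ℤ[X]) * C (f.coeff 0) = 1 := by
    rw [← C_mul, ← hu, Units.inv_mul, C_1]
  linear_combination (-C (↑u⁻¹ : ℤ) : ℤ[X]) * h1 + h2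

/-- Lagrange interpolation bounds the integer coefficients by the values on `Λ`. -/
theorem finite_setOf_norm_aeval_le (Λ : Finset ℂ) (R : ℝ) :
    {p : ℤ[X] | p.degree < Λ.card ∧ ∀ z ∈ Λ, ‖aeval z p‖ ≤ R}.Finite := by
  set B : ℕ → ℤ := fun i => ⌈∑ z ∈ Λ, R * ‖(Lagrange.basis Λ id z).coeff i‖⌉ with hB
  have hfin : (Set.univ.pi fun i : Fin Λ.card => Set.Icc (-B i) (B i)).Finite :=
    Set.Finite.pi fun i => Set.finite_Icc _ _
  have hinj : Set.InjOn (fun (p : ℤ[X]) (i : Fin Λ.card) => p.coeff i)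
      {p : ℤ[X] | p.degree < Λ.card ∧ ∀ z ∈ Λ, ‖aeval z p‖ ≤ R} := by
    intro p hp q hq h
    ext i
    by_cases hi : i < Λ.card
    · exact congrFun h ⟨i, hi⟩
    · have hi' : (Λ.card : WithBot ℕ) ≤ i := by exact_mod_cast not_lt.1 hi
      rw [coeff_eq_zero_of_degree_lt (hp.1.trans_le hi'),
        coeff_eq_zero_of_degree_lt (hq.1.trans_le hi')]
  refine Set.Finite.of_finite_image (hfin.subset ?_) hinj
  rintro _ ⟨p, ⟨hpd, hpR⟩, rfl⟩ i -
  have hint := Lagrange.eq_interpolate (s := Λ) (v := id) (f := p.map (algebraMap ℤ ℂ))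
    Function.injective_id.injOn ((degree_map_le).trans_lt hpd)
  have hco := congrArg (fun q => q.coeff (i : ℕ)) hint
  simp only [Lagrange.interpolate_apply, finsetSum_coeff, coeff_C_mul, coeff_map, id,
    eval_map_algebraMap] at hco
  have hle : ‖(p.coeff i : ℂ)‖ ≤ ∑ z ∈ Λ, R * ‖(Lagrange.basis Λ id z).coeff i‖ := by
    have : (p.coeff i : ℂ) = algebraMap ℤ ℂ (p.coeff i) := rfl
    rw [this, hco]
    refine (norm_sum_le _ _).trans (Finset.sum_le_sum fun z hz => ?_)
    rw [norm_mul]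
    exact mul_le_mul_of_nonneg_right (hpR z hz) (norm_nonneg _)
  rw [Complex.norm_intCast] at hle
  have h3 : (|p.coeff i| : ℤ) ≤ B i := by
    have := hle.trans (Int.le_ceil _)
    exact_mod_cast this
  exact abs_le.1 h3

/-- An integer polynomial is a sum of `K` integer polynomials close to its `K`-th part. -/
theorem exists_sum_eq_and_norm_sub_le {v : ℤ[X]} {d : ℕ} (hv : v.degree < d) {K : ℕ} (hK : 0 < K) :
    ∃ g : ℕ → ℤ[X], (∀ k, (g k).degree < d) ∧ ∑ k ∈ Finset.range K, g k = v ∧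
      ∀ (𝕜 : Type) [RCLike 𝕜] (z : 𝕜) (k : ℕ),
        ‖aeval z (g k) - aeval z v / K‖ ≤ ∑ i ∈ Finset.range d, ‖z‖ ^ i := by
  let t : ℕ → ℝ := fun i => v.coeff i / K
  -- Rounding multiples of the real coefficient and taking differences gives integers that sum to
  -- `v.coeff i`, each within 1 of `t i`.
  let e : ℕ → ℕ → ℤ := fun k i => ⌊(k : ℝ) * t i⌋
  have hK0 : (K : ℝ) ≠ 0 := by exact_mod_cast hK.ne'
  have hvs : v = ∑ i ∈ Finset.range d, C (v.coeff i) * X ^ i := by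
    ext n
    simp only [finsetSum_coeff, coeff_C_mul, coeff_X_pow, mul_ite, mul_one, mul_zero,
      Finset.sum_ite_eq, Finset.mem_range]
    split_ifs with h
    · rfl
    · exact (degree_lt_iff_coeff_zero v d).1 hv n (not_lt.1 h)
  refine ⟨fun k => ∑ i ∈ Finset.range d, C (e (k + 1) i - e k i) * X ^ i, fun k => ?_, ?_, ?_⟩
  · refine (degree_lt_iff_coeff_zero _ d).2 fun n hn => ?_
    simp only [finsetSum_coeff, coeff_C_mul, coeff_X_pow, mul_ite, mul_one, mul_zero,
      Finset.sum_ite_eq, Finset.mem_range, if_neg (not_lt.2 hn)]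
  · rw [Finset.sum_comm]
    conv_rhs => rw [hvs]
    refine Finset.sum_congr rfl fun i _ => ?_
    rw [← Finset.sum_mul, ← map_sum, Finset.sum_range_sub (fun k => e k i)]
    congr 2
    have h1 : e K i = v.coeff i := by
      simp only [e, t, mul_div_cancel₀ _ hK0]
      exact Int.floor_intCast _
    have h2 : e 0 i = 0 := by simp [e]
    rw [h1, h2, sub_zero]
  · intro 𝕜 _ z k
    have h1 : aeval z v / (K : 𝕜) = ∑ i ∈ Finset.range d, ((t i : ℝ) : 𝕜) * z ^ i := by
      conv_lhs => rw [hvs]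
      rw [map_sum, Finset.sum_div]
      refine Finset.sum_congr rfl fun i _ => ?_
      simp [t]
      ring
    rw [h1, map_sum, ← Finset.sum_sub_distrib]
    refine (norm_sum_le _ _).trans (Finset.sum_le_sum fun i _ => ?_)
    have h2 : aeval z (C (e (k + 1) i - e k i) * X ^ i) - ((t i : ℝ) : 𝕜) * z ^ i =
        (((e (k + 1) i - e k i : ℤ) - t i : ℝ) : 𝕜) * z ^ i := by
      simp
      ring
    rw [h2, norm_mul, norm_pow, RCLike.norm_ofReal]
    refine mul_le_of_le_one_left (by positivity) ?_
    simp only [e]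
    rw [abs_le]
    push_cast
    have a1 := Int.floor_le (((k : ℝ) + 1) * t i)
    have a2 := Int.lt_floor_add_one (((k : ℝ) + 1) * t i)
    have a3 := Int.floor_le ((k : ℝ) * t i)
    have a4 := Int.lt_floor_add_one ((k : ℝ) * t i)
    constructor <;> linarith

end PolynomialLattice

/-- For large `m` there is an exponent `j` for which `(x ^ m - 1) / x ^ j` is large and balanced in
the two extremal directions `x = α` and `x = δ`, and relatively small in between. -/
theorem eventually_exists_balanced {α δ : ℝ} (hα : 1 < α) (hδ : 0 < δ) (hδ1 : δ < 1) (Λ : Finset ℂ)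
    (hΛ : ∀ z ∈ Λ, δ < ‖z‖ ∧ ‖z‖ < α) {A B : ℝ} (hA : 0 < A) (hB : 0 < B) (c : ℂ → ℝ)
    (hc : ∀ z, 0 ≤ c z) (R : ℝ) :
    ∀ᶠ m : ℕ in atTop, ∃ j : ℕ, 0 < j ∧ j < m ∧ ∃ μ : ℝ, R ≤ μ ∧
      μ ≤ (α ^ m - 1) * A / α ^ j ∧ (α ^ m - 1) * A / α ^ j ≤ 2 * (α / δ) * μ ∧
      μ ≤ (1 - δ ^ m) * B / δ ^ j ∧ (1 - δ ^ m) * B / δ ^ j ≤ 2 * (α / δ) * μ ∧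
      ∀ z ∈ Λ, ‖z ^ m - 1‖ * c z / ‖z‖ ^ j ≤ μ / 4 := by
  have hα0 : 0 < α := by linarith
  have hq : 1 < α / δ := by rw [one_lt_div hδ]; linarith
  have hδi : 1 < δ⁻¹ := (one_lt_inv₀ hδ).2 hδ1
  have tδ := tendsto_pow_atTop_atTop_of_one_lt hδi
  have e1 : ∀ᶠ j : ℕ in atTop, ∀ z ∈ Λ, (δ / ‖z‖) ^ j * c z ≤ B / 16 := by
    rw [Filter.eventually_all_finset]
    intro z hz
    have hz0 : 0 < ‖z‖ := hδ.trans (hΛ z hz).1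
    have := (tendsto_pow_atTop_nhds_zero_of_lt_one (by positivity)
      ((div_lt_one hz0).2 (hΛ z hz).1)).mul_const (c z)
    rw [zero_mul] at this
    exact (this.eventually (gt_mem_nhds (by positivity : (0 : ℝ) < B / 16))).mono fun _ h => h.le
  have e2 : ∀ᶠ i : ℕ in atTop, ∀ z ∈ Λ, (‖z‖ / α) ^ i * (c z * (α / δ * B / A)) ≤ B / 16 := by
    rw [Filter.eventually_all_finset]
    intro z hz
    have := (tendsto_pow_atTop_nhds_zero_of_lt_one (by positivity)
      ((div_lt_one hα0).2 (hΛ z hz).2)).mul_const (c z * (α / δ * B / A))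
    rw [zero_mul] at this
    exact (this.eventually (gt_mem_nhds (by positivity : (0 : ℝ) < B / 16))).mono fun _ h => h.le
  obtain ⟨I, hI⟩ := eventually_atTop.1 e2
  obtain ⟨J, hJ⟩ := eventually_atTop.1 (e1.and ((eventually_gt_atTop 0).and
    ((tδ.eventually_ge_atTop (2 * R / B)).and (tδ.eventually_gt_atTop (α ^ I * A / B)))))
  have tα := tendsto_pow_atTop_atTop_of_one_lt hα
  filter_upwards [tα.eventually_ge_atTop (B / A), tα.eventually_gt_atTop ((α / δ) ^ J * B / A),
    tα.eventually_ge_atTop 2,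
    (tendsto_pow_atTop_nhds_zero_of_lt_one hδ.le hδ1).eventually
      (gt_mem_nhds (by norm_num : (0 : ℝ) < 1 / 2))] with m m1 m2 m3 m4
  have hx1 : 1 ≤ α ^ m * A / B := by
    rw [one_le_div hB]; rwa [div_le_iff₀ hA] at m1
  -- Balance requires `α ^ m * A / α ^ j` to be about `B / δ ^ j`; this `j` achieves it up to a
  -- factor `α / δ`. Large `m` makes both `j` and `m - j` large.
  obtain ⟨j, hj1, hj2⟩ := exists_nat_pow_near hx1 hq
  have hJj : J ≤ j := by
    by_contra hlt
    have h1 : (α / δ) ^ (j + 1) ≤ (α / δ) ^ J := pow_le_pow_right₀ hq.le (by omega)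
    have h2 : α ^ m * A / B < (α / δ) ^ J := hj2.trans_le h1
    rw [div_lt_iff₀ hB] at h2
    rw [div_lt_iff₀ hA] at m2
    linarith
  obtain ⟨j1, j2, j3, j4⟩ := hJ j hJj
  have hpj : 0 < α ^ j := by positivity
  have hdj : 0 < δ ^ j := by positivity
  set P : ℝ := δ⁻¹ ^ j with hP
  have hP0 : 0 < P := by positivity
  have hPd : P * δ ^ j = 1 := by rw [hP, ← mul_pow, inv_mul_cancel₀ hδ.ne', one_pow]
  have hqj : (α / δ) ^ j = α ^ j * P := by rw [hP, ← mul_pow, div_eq_mul_inv]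
  have k1 : α ^ j * P * B ≤ α ^ m * A := by
    rw [hqj, le_div_iff₀ hB] at hj1
    exact hj1
  have k2 : α ^ m * A ≤ α ^ j * P * (α / δ) * B := by
    rw [pow_succ, hqj, div_lt_iff₀ hB] at hj2
    exact hj2.le
  have hIm : I + j < m := by
    rw [div_lt_iff₀ hB] at j4
    have h1 : α ^ (I + j) * A < α ^ m * A := by
      refine lt_of_lt_of_le ?_ k1
      rw [pow_add]
      have := mul_lt_mul_of_pos_left j4 hpj
      linarith
    exact (pow_lt_pow_iff_right₀ hα).1 (lt_of_mul_lt_mul_right h1 hA.le)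
  -- The half absorbs the replacement of `α ^ m - 1` by `α ^ m` and of `1 - δ ^ m` by 1.
  refine ⟨j, j2, by omega, P * B / 2, ?_, ?_, ?_, ?_, ?_, ?_⟩
  · rw [div_le_iff₀ hB] at j3
    linarith
  · rw [le_div_iff₀ hpj]
    have : α ^ m * A ≤ 2 * ((α ^ m - 1) * A) := by nlinarith
    linarith
  · rw [div_le_iff₀ hpj]
    have : (α ^ m - 1) * A ≤ α ^ m * A := by nlinarith
    refine (this.trans k2).trans (le_of_eq ?_)
    ring
  · rw [le_div_iff₀ hdj]
    have : P * B / 2 * δ ^ j = B / 2 := by linear_combination B / 2 * hPd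
    rw [this]
    nlinarith
  · rw [div_le_iff₀ hdj]
    have : 2 * (α / δ) * (P * B / 2) * δ ^ j = α / δ * B := by
      linear_combination (α / δ) * B * hPd
    rw [this]
    have : 0 < δ ^ m := by positivity
    nlinarith
  · intro z hz
    have hz0 : 0 < ‖z‖ := hδ.trans (hΛ z hz).1
    have hzj : 0 < ‖z‖ ^ j := by positivity
    have hn : ‖z ^ m - 1‖ ≤ ‖z‖ ^ m + 1 := by
      refine (norm_sub_le _ _).trans ?_
      rw [norm_pow, norm_one]
    -- The two parts of `‖z‖ ^ m + 1` are handled separately: `s1` uses `δ < ‖z‖` with `j` large,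
    -- `s2` uses `‖z‖ < α` with `m - j` large.
    have s1 : c z / ‖z‖ ^ j ≤ P * B / 16 := by
      have h1 := j1 z hz
      rw [div_pow] at h1
      have h2 : c z / ‖z‖ ^ j = P * (δ ^ j / ‖z‖ ^ j * c z) := by
        rw [div_mul_eq_mul_div, ← mul_div_assoc, ← mul_assoc, hPd, one_mul]
      rw [h2]
      have := mul_le_mul_of_nonneg_left h1 hP0.le
      linarith
    have s2 : ‖z‖ ^ m * c z / ‖z‖ ^ j ≤ P * B / 16 := by
      obtain ⟨i, rfl⟩ : ∃ i, m = j + i := ⟨m - j, by omega⟩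
      have h1 := hI i (by omega) z hz
      have h3 : α ^ i * A ≤ P * (α / δ) * B := by
        rw [pow_add] at k2
        refine le_of_mul_le_mul_left ?_ hpj
        linarith
      have h4 : ‖z‖ ^ (j + i) * c z / ‖z‖ ^ j = (‖z‖ / α) ^ i * c z * α ^ i := by
        rw [pow_add, div_pow]
        field_simp
      rw [h4]
      have h5 : α ^ i ≤ P * (α / δ * B / A) := by
        rw [← mul_div_assoc, le_div_iff₀ hA]
        linarith
      calc (‖z‖ / α) ^ i * c z * α ^ i ≤ (‖z‖ / α) ^ i * c z * (P * (α / δ * B / A)) :=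
            mul_le_mul_of_nonneg_left h5 (mul_nonneg (by positivity) (hc z))
        _ = P * ((‖z‖ / α) ^ i * (c z * (α / δ * B / A))) := by ring
        _ ≤ P * (B / 16) := mul_le_mul_of_nonneg_left h1 hP0.le
        _ = _ := by ring
    calc ‖z ^ m - 1‖ * c z / ‖z‖ ^ j ≤ (‖z‖ ^ m + 1) * c z / ‖z‖ ^ j := by
          gcongr
          exact hc z
      _ = ‖z‖ ^ m * c z / ‖z‖ ^ j + c z / ‖z‖ ^ j := by ring
      _ ≤ P * B / 2 / 4 := by linarith

/-! ### A finite set of polynomials closed under the orbit relations. -/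

section BalancedPolynomials

open Polynomial

/-- Integer polynomials of degree less than `d` with values in `[1, C]` at `α` and `δ`, and of
modulus at most `2 * r` on `Λ`. -/
def balancedPolynomials (d : ℕ) (α δ : ℝ) (Λ : Finset ℂ) (C r : ℝ) : Set ℤ[X] :=
  {p | p.degree < d ∧ aeval α p ∈ Set.Icc 1 C ∧ aeval δ p ∈ Set.Icc 1 C ∧
    ∀ z ∈ Λ, ‖aeval z p‖ ≤ 2 * r}

/-- Cut `v` into `K` nearly equal lattice pieces; `r` bounds the rounding error at every point of
modulus at most `α`. The bounds on the pieces do not involve `μ`. -/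
theorem exists_sum_balancedPolynomials {v : ℤ[X]} {d : ℕ} (hd : 0 < d) (hv : v.degree < d)
    {α δ : ℝ} (hα : 1 ≤ α) (hδ : 0 < δ) (hδα : δ ≤ α) {Λ : Finset ℂ} (hΛ : ∀ z ∈ Λ, ‖z‖ ≤ α)
    {κ μ r : ℝ} (hr : r = ∑ i ∈ Finset.range d, α ^ i) (hμ : 1 + r ≤ μ)
    (h1 : μ ≤ aeval α v) (h2 : aeval α v ≤ κ * μ) (h3 : μ ≤ aeval δ v) (h4 : aeval δ v ≤ κ * μ)
    (h5 : ∀ z ∈ Λ, ‖aeval z v‖ ≤ μ / 4) :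
    ∃ K : ℕ, 0 < K ∧ ∃ g : ℕ → ℤ[X], ∑ k ∈ Finset.range K, g k = v ∧
      ∀ k, g k ∈ balancedPolynomials d α δ Λ (2 * κ * (1 + r) + r) r := by
  have hr1 : 1 ≤ r := by
    rw [hr]
    have := Finset.single_le_sum (f := fun i => α ^ i) (fun i _ => by positivity)
      (Finset.mem_range.2 hd)
    simpa using this
  have hμ0 : 0 < μ := by linarith
  have hκ : 0 ≤ κ := by
    by_contra! h
    nlinarith
  -- A share of at least `1 + r` remains at least 1 after rounding; the upper bound `2 * (1 + r)`
  -- gives the constant `2 * κ * (1 + r) + r`.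
  obtain ⟨K, hK, hK1, hK2⟩ : ∃ K : ℕ, 0 < K ∧ (1 + r) ≤ μ / K ∧ μ / K ≤ 2 * (1 + r) := by
    have hx : 1 ≤ μ / (1 + r) := by rwa [one_le_div (by linarith)]
    have hK : 1 ≤ ⌊μ / (1 + r)⌋₊ := Nat.one_le_floor_iff _ |>.2 hx
    have hK' : (1 : ℝ) ≤ (⌊μ / (1 + r)⌋₊ : ℕ) := by exact_mod_cast hK
    have f1 := Nat.floor_le (zero_le_one.trans hx)
    have f2 := Nat.lt_floor_add_one (μ / (1 + r))
    rw [le_div_iff₀ (by linarith)] at f1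
    rw [div_lt_iff₀ (by linarith)] at f2
    refine ⟨_, hK, ?_, ?_⟩
    · rw [le_div_iff₀ (by linarith)]
      linarith
    · rw [div_le_iff₀ (by linarith)]
      nlinarith
  have hK0 : (0 : ℝ) < K := by exact_mod_cast hK
  obtain ⟨g, hg1, hg2, hg3⟩ := exists_sum_eq_and_norm_sub_le hv hK
  have hgr : ∀ (𝕜 : Type) [RCLike 𝕜] (z : 𝕜) (k : ℕ), ‖z‖ ≤ α →
      ‖aeval z (g k) - aeval z v / K‖ ≤ r := by
    intro 𝕜 _ z k hz
    refine (hg3 𝕜 z k).trans ?_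
    rw [hr]
    gcongr
  have hreal : ∀ t : ℝ, 0 < t → t ≤ α → μ ≤ aeval t v → aeval t v ≤ κ * μ → ∀ k,
      aeval t (g k) ∈ Set.Icc 1 (2 * κ * (1 + r) + r) := by
    intro t ht htα ht1 ht2 k
    have h := hgr ℝ t k (by rwa [Real.norm_eq_abs, abs_of_pos ht])
    rw [Real.norm_eq_abs, abs_le] at h
    have q1 : μ / K ≤ aeval t v / K := by gcongr
    have q2 : aeval t v / K ≤ κ * (μ / K) := by
      rw [← mul_div_assoc]; gcongr
    have q3 : κ * (μ / K) ≤ κ * (2 * (1 + r)) := mul_le_mul_of_nonneg_left hK2 hκ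
    constructor <;> linarith
  refine ⟨K, hK, g, hg2, fun k => ⟨hg1 k, hreal α (by linarith) le_rfl h1 h2 k,
    hreal δ hδ hδα h3 h4 k, fun z hz => ?_⟩⟩
  have h := hgr ℂ z k (hΛ z hz)
  have q : ‖aeval z v / (K : ℂ)‖ ≤ r := by
    rw [norm_div, Complex.norm_natCast, div_le_iff₀ hK0]
    rw [div_le_iff₀ hK0] at hK2
    have := h5 z hz
    nlinarith
  have := norm_add_le (aeval z (g k) - aeval z v / (K : ℂ)) (aeval z v / (K : ℂ))
  rw [sub_add_cancel] at this
  linarith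

theorem aeval_ofReal_complex (t : ℝ) (p : ℤ[X]) : aeval (t : ℂ) p = ((aeval t p : ℝ) : ℂ) :=
  aeval_algebraMap_apply ℂ t p

/-- For a separable integral polynomial with unit constant coefficient whose roots other than
`δ < 1 < α` lie in the annulus `δ < |z| < α`, there are finitely many integer polynomials with
positive values at `α` and `δ` that satisfy the relations needed for a bipositive matrix. -/
theorem exists_orbit_relations {f : ℤ[X]} (hf : f.Monic) (hf0 : IsUnit (f.coeff 0))
    (hsep : (f.map (algebraMap ℤ ℂ)).Separable) {α δ : ℝ} (hα : 1 < α) (hδ : 0 < δ) (hδ1 : δ < 1)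
    (hfα : aeval (α : ℂ) f = 0) (hfδ : aeval (δ : ℂ) f = 0)
    (hroots : ∀ z : ℂ, aeval z f = 0 → z ≠ α → z ≠ δ → δ < ‖z‖ ∧ ‖z‖ < α) :
    ∃ (F : Set ℤ[X]) (_ : F.Finite) (_ : F.Nonempty) (m : ℕ) (j : F → ℕ) (c : F → F → ℕ),
      (∀ p ∈ F, 0 < aeval α p ∧ 0 < aeval δ p) ∧ (∀ s, 0 < j s ∧ j s < m) ∧
      ∀ (_ : Fintype F) (x : ℝ), x = α ∨ x = δ → ∀ s : F,
        (x ^ m - 1) * (x - 1) * aeval x (s : ℤ[X]) =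
          x ^ j s * ∑ t : F, c s t * aeval x (t : ℤ[X]) := by
  classical
  set d := f.natDegree with hd
  set Λ₀ : Finset ℂ := (f.map (algebraMap ℤ ℂ)).roots.toFinset with hΛ₀
  have hfne : f.map (algebraMap ℤ ℂ) ≠ 0 := (hf.map _).ne_zero
  have hmem : ∀ z, z ∈ Λ₀ ↔ aeval z f = 0 := by
    intro z
    rw [hΛ₀, Multiset.mem_toFinset, mem_roots hfne, IsRoot.def, eval_map_algebraMap]
  have hcard : Λ₀.card = d := by
    rw [hΛ₀, Multiset.toFinset_card_of_nodup (nodup_roots hsep),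
      ← (IsAlgClosed.splits _).natDegree_eq_card_roots, hf.natDegree_map]
  have hd0 : 0 < d := by
    rw [← hcard]
    exact Finset.card_pos.2 ⟨_, (hmem _).2 hfα⟩
  set Λ : Finset ℂ := Λ₀.filter fun z => z ≠ α ∧ z ≠ δ with hΛ
  have hΛr : ∀ z ∈ Λ, aeval z f = 0 ∧ δ < ‖z‖ ∧ ‖z‖ < α := by
    intro z hz
    obtain ⟨h1, h2, h3⟩ := Finset.mem_filter.1 hz
    exact ⟨(hmem z).1 h1, hroots z ((hmem z).1 h1) h2 h3⟩
  set r : ℝ := ∑ i ∈ Finset.range d, α ^ i with hr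
  set κ : ℝ := 2 * (α / δ) with hκ
  set C : ℝ := 2 * κ * (1 + r) + r with hC
  set F := balancedPolynomials d α δ Λ C r with hF
  have hFfin : F.Finite := by
    refine (finite_setOf_norm_aeval_le Λ₀ (max C (2 * r))).subset fun p hp => ⟨?_, fun z hz => ?_⟩
    · rw [hcard]; exact hp.1
    · have hreal : ∀ t : ℝ, aeval t p ∈ Set.Icc 1 C → ‖aeval (t : ℂ) p‖ ≤ max C (2 * r) := by
        intro t ht
        rw [aeval_ofReal_complex, Complex.norm_real, Real.norm_eq_abs,
          abs_of_nonneg (zero_le_one.trans ht.1)]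
        exact ht.2.trans (le_max_left _ _)
      by_cases h1 : z = α
      · rw [h1]; exact hreal α hp.2.1
      by_cases h2 : z = δ
      · rw [h2]; exact hreal δ hp.2.2.1
      · exact (hp.2.2.2 z (Finset.mem_filter.2 ⟨hz, h1, h2⟩)).trans (le_max_right _ _)
  obtain ⟨q, hq⟩ := exists_dvd_X_mul_sub_one hf0
  have hqz : ∀ (𝕜 : Type) [Field 𝕜] (z : 𝕜), aeval z f = 0 → aeval z q = z⁻¹ := by
    intro 𝕜 _ z hz
    have := aeval_eq_zero_of_dvd_aeval_eq_zero hq hz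
    rw [map_sub, map_mul, aeval_X, map_one, sub_eq_zero] at this
    exact eq_inv_of_mul_eq_one_right this
  have hfα' : aeval α f = 0 := by
    rw [aeval_ofReal_complex] at hfα; exact_mod_cast hfα
  have hfδ' : aeval δ f = 0 := by
    rw [aeval_ofReal_complex] at hfδ; exact_mod_cast hfδ
  -- How large `m` must be depends on `w`, but the target set `F` does not; finiteness of `F` then
  -- lets one `m` serve all its elements.
  have claim : ∀ w : ℤ[X], 0 < aeval α w → 0 < aeval δ w → ∀ᶠ m : ℕ in atTop,
      ∃ j : ℕ, 0 < j ∧ j < m ∧ ∃ K : ℕ, 0 < K ∧ ∃ g : ℕ → ℤ[X], (∀ k, g k ∈ F) ∧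
        ∀ x : ℝ, x = α ∨ x = δ → (x ^ m - 1) * (x - 1) * aeval x w =
          x ^ j * ∑ k ∈ Finset.range K, aeval x (g k) := by
    intro w hwα hwδ
    filter_upwards [eventually_exists_balanced hα hδ hδ1 Λ (fun z hz => (hΛr z hz).2)
      (mul_pos (sub_pos.2 hα) hwα) (mul_pos (sub_pos.2 hδ1) hwδ) (fun z => ‖(z - 1) * aeval z w‖)
      (fun z => norm_nonneg _) (1 + r)] with m hm
    obtain ⟨j, hj0, hjm, μ, hμ, b1, b2, b3, b4, b5⟩ := hm
    set v : ℤ[X] := (q ^ j * ((X ^ m - 1) * ((X - 1) * w))) %ₘ f with hv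
    have hvd : v.degree < d := by
      rw [hd, ← degree_eq_natDegree hf.ne_zero]
      exact degree_modByMonic_lt _ hf
    have hvz : ∀ (𝕜 : Type) [Field 𝕜] (z : 𝕜), aeval z f = 0 →
        aeval z v = (z ^ m - 1) * ((z - 1) * aeval z w) / z ^ j := by
      intro 𝕜 _ z hz
      rw [hv, aeval_modByMonic_eq_self_of_root hz]
      simp only [map_mul, map_pow, map_sub, aeval_X, map_one, hqz 𝕜 z hz]
      rw [inv_pow, inv_mul_eq_div]
    have vα := hvz ℝ α hfα'
    have vδ := hvz ℝ δ hfδ'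
    have vδ' : aeval δ v = (1 - δ ^ m) * ((1 - δ) * aeval δ w) / δ ^ j := by
      rw [vδ]; ring
    obtain ⟨K, hK, g, hg, hgF⟩ := exists_sum_balancedPolynomials hd0 hvd hα.le hδ
      (by linarith) (fun z hz => (hΛr z hz).2.2.le) (κ := κ) hr hμ (vα ▸ b1) (vα ▸ b2)
      (vδ' ▸ b3) (vδ' ▸ b4) (fun z hz => by
        rw [hvz ℂ z (hΛr z hz).1, norm_div, norm_mul, norm_pow]
        exact b5 z hz)
    refine ⟨j, hj0, hjm, K, hK, g, hgF, ?_⟩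
    rintro x (rfl | rfl)
    · rw [← map_sum, hg, vα]
      field_simp
    · rw [← map_sum, hg, vδ]
      field_simp
  have hFpos : ∀ p ∈ F, 0 < aeval α p ∧ 0 < aeval δ p := fun p hp =>
    ⟨zero_lt_one.trans_le hp.2.1.1, zero_lt_one.trans_le hp.2.2.1.1⟩
  have hFne : F.Nonempty := by
    obtain ⟨m, j, -, -, K, -, g, hg, -⟩ := (claim 1 (by simp) (by simp)).exists
    exact ⟨g 0, hg 0⟩
  obtain ⟨m, hm⟩ := ((Filter.eventually_all_finite hFfin).2 fun p hp =>
    claim p (hFpos p hp).1 (hFpos p hp).2).exists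
  choose! j hj0 hjm K hK g hgF hg using hm
  -- The coefficient `c s t` counts how often `t` occurs among the pieces for `s`.
  refine ⟨F, hFfin, hFne, m, fun s => j s, fun s t =>
    ((Finset.range (K s)).filter fun k => g s k = t).card, hFpos,
    fun s => ⟨hj0 s s.2, hjm s s.2⟩, fun _ x hx s => ?_⟩
  rw [hg s s.2 x hx]
  congr 1
  have e : ∀ k, aeval x (g s k) = ∑ t : F, if g s k = t then aeval x (t : ℤ[X]) else 0 := by
    intro k
    rw [Finset.sum_eq_single_of_mem ⟨g s k, hgF s s.2 k⟩ (Finset.mem_univ _)]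
    · simp
    · intro t _ ht
      rw [if_neg]
      exact fun h => ht (Subtype.ext h.symm)
  rw [Finset.sum_congr rfl fun k _ => e k, Finset.sum_comm]
  refine Finset.sum_congr rfl fun t _ => ?_
  rw [← Finset.sum_filter, Finset.sum_const, nsmul_eq_mul]

end BalancedPolynomials

/-! ### Conjugates of algebraic units and of their powers. -/

section Conjugates

open Polynomial

/-- Lift the conjugacy to an automorphism of the algebraic closure of `K` in `L` and apply it to
`x`. -/
theorem exists_isConjRoot_pow_eq {K L : Type*} [Field K] [Field L] [Algebra K L] [IsAlgClosed L]
    {x z : L} (hx : IsIntegral K x) {N : ℕ} (h : IsConjRoot K (x ^ N) z) :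
    ∃ y, IsConjRoot K x y ∧ z = y ^ N := by
  have hz : IsIntegral K z := h.isIntegral (hx.pow N)
  let Ω := algebraicClosure K L
  have : IsAlgClosure K Ω := algebraicClosure.isAlgClosure K L
  have : Normal K Ω := IsAlgClosure.normal K Ω
  let x' : Ω := ⟨x, mem_algebraicClosure_iff.2 hx.isAlgebraic⟩
  let z' : Ω := ⟨z, mem_algebraicClosure_iff.2 hz.isAlgebraic⟩
  have h' : IsConjRoot K (x' ^ N) z' := (isConjRoot_algHom_iff Ω.val).1 h
  obtain ⟨σ, hσ⟩ := isConjRoot_iff_exists_algEquiv.1 h'.symm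
  refine ⟨σ x', (isConjRoot_algHom_iff Ω.val (x := x') (y := σ x')).2 ?_, ?_⟩
  · exact isConjRoot_iff_exists_algEquiv.2 ⟨σ.symm, σ.symm_apply_apply x'⟩
  · rw [map_pow] at hσ
    exact (congrArg Ω.val hσ).symm

theorem isIntegral_ofReal {x : ℝ} (h : IsIntegral ℤ x) : IsIntegral ℤ (x : ℂ) :=
  h.map (Complex.ofRealAm.restrictScalars ℤ)

/-- The reverse of a monic polynomial killing `x⁻¹` kills `x` and has constant term 1; the minimal
polynomial of `x` divides it. -/
theorem isUnit_coeff_zero_minpoly {x : ℝ} (h : IsAlgebraicUnit x) :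
    IsUnit ((minpoly ℤ (x : ℂ)).coeff 0) := by
  obtain ⟨hx0, hx, p, hp, hpx⟩ := h
  have hrev : aeval x p.reverse = 0 := by
    let _ : Invertible x⁻¹ := invertibleOfNonzero (inv_ne_zero hx0)
    have := (eval₂_reverse_eq_zero_iff (algebraMap ℤ ℝ) x⁻¹ p).2 hpx
    rwa [invOf_eq_inv, inv_inv] at this
  have hrev' : aeval (x : ℂ) p.reverse = 0 := by
    rw [aeval_ofReal_complex, hrev, Complex.ofReal_zero]
  obtain ⟨g, hg⟩ := minpoly.isIntegrallyClosed_dvd (isIntegral_ofReal hx) hrev'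
  have := congrArg (fun q => q.coeff 0) hg
  simp only [coeff_zero_reverse, hp.leadingCoeff, mul_coeff_zero] at this
  exact IsUnit.of_mul_eq_one _ this.symm

theorem map_minpoly_int {x : ℂ} (h : IsIntegral ℤ x) :
    (minpoly ℤ x).map (algebraMap ℤ ℚ) = minpoly ℚ x :=
  (minpoly.isIntegrallyClosed_eq_field_fractions' ℚ h).symm

theorem aeval_minpoly_int_eq_zero_iff {x : ℂ} (h : IsIntegral ℤ x) (z : ℂ) :
    aeval z (minpoly ℤ x) = 0 ↔ IsConjRoot ℚ x z := by
  rw [isConjRoot_iff_aeval_eq_zero (h.tower_top), ← map_minpoly_int h, aeval_map_algebraMap]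

theorem separable_map_minpoly_int {x : ℂ} (h : IsIntegral ℤ x) :
    ((minpoly ℤ x).map (algebraMap ℤ ℂ)).Separable := by
  rw [IsScalarTower.algebraMap_eq ℤ ℚ ℂ, ← Polynomial.map_map, map_minpoly_int h]
  exact (minpoly.irreducible h.tower_top).separable.map

theorem prod_norm_conj_eq_one {x : ℝ} (h : IsAlgebraicUnit x) :
    ∏ z ∈ ((minpoly ℤ (x : ℂ)).map (algebraMap ℤ ℂ)).roots.toFinset, ‖z‖ = 1 := by
  have hint := isIntegral_ofReal h.2.1
  have hm := (minpoly.monic hint).map (algebraMap ℤ ℂ)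
  have h1 := (IsAlgClosed.splits ((minpoly ℤ (x : ℂ)).map (algebraMap ℤ ℂ))).coeff_zero_eq_prod_roots_of_monic hm
  have h2 : ‖((minpoly ℤ (x : ℂ)).map (algebraMap ℤ ℂ)).coeff 0‖ = 1 := by
    rw [coeff_map]
    rcases Int.isUnit_iff.1 (isUnit_coeff_zero_minpoly h) with h | h <;> simp [h]
  rw [h1, norm_mul, norm_pow, norm_neg, norm_one, one_pow, one_mul] at h2
  rw [← norm_prod, ← h2]
  congr 1
  rw [Finset.prod_multiset_count]
  refine Finset.prod_congr rfl fun z hz => ?_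
  rw [Multiset.count_eq_one_of_mem (nodup_roots (separable_map_minpoly_int hint))
    (Multiset.mem_toFinset.1 hz), pow_one]

theorem mem_roots_toFinset_iff {x : ℝ} (h : IsAlgebraicUnit x) (z : ℂ) :
    z ∈ ((minpoly ℤ (x : ℂ)).map (algebraMap ℤ ℂ)).roots.toFinset ↔ IsConjRoot ℚ (x : ℂ) z := by
  have hint := isIntegral_ofReal h.2.1
  rw [Multiset.mem_toFinset, mem_roots ((minpoly.monic hint).map _).ne_zero, IsRoot.def,
    eval_map_algebraMap, aeval_minpoly_int_eq_zero_iff hint]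

theorem one_le_of_prod_eq_one {κ : Type*} {s : Finset κ} {g : κ → ℝ} (h0 : ∀ z ∈ s, 0 ≤ g z)
    (h1 : ∀ z ∈ s, g z ≤ 1) (hp : ∏ z ∈ s, g z = 1) {x : κ} (hx : x ∈ s) : 1 ≤ g x := by
  classical
  rw [← Finset.mul_prod_erase s g hx] at hp
  have := Finset.prod_le_one (s := s.erase x) (fun z hz => h0 z (Finset.mem_of_mem_erase hz))
    (fun z hz => h1 z (Finset.mem_of_mem_erase hz))
  nlinarith [h0 x hx]

theorem one_le_norm_of_conj_norm_le_one {x : ℝ} (h : IsAlgebraicUnit x)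
    (hc : ∀ z, IsConjRoot ℚ (x : ℂ) z → ‖z‖ ≤ 1) : 1 ≤ ‖(x : ℂ)‖ :=
  one_le_of_prod_eq_one (fun z _ => norm_nonneg z)
    (fun z hz => hc z ((mem_roots_toFinset_iff h z).1 hz)) (prod_norm_conj_eq_one h)
    ((mem_roots_toFinset_iff h _).2 (IsConjRoot.refl))

theorem norm_le_one_of_one_le_conj_norm {x : ℝ} (h : IsAlgebraicUnit x)
    (hc : ∀ z, IsConjRoot ℚ (x : ℂ) z → 1 ≤ ‖z‖) : ‖(x : ℂ)‖ ≤ 1 := by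
  have := one_le_of_prod_eq_one (g := fun z : ℂ => ‖z‖⁻¹) (fun z _ => inv_nonneg.2 (norm_nonneg z))
    (fun z hz => inv_le_one_of_one_le₀ (hc z ((mem_roots_toFinset_iff h z).1 hz)))
    (by rw [Finset.prod_inv_distrib, prod_norm_conj_eq_one h, inv_one])
    ((mem_roots_toFinset_iff h _).2 (IsConjRoot.refl))
  exact (one_le_inv₀ (norm_pos_iff.2 (by exact_mod_cast h.1))).1 this

theorem IsAlgebraicUnit.pow {x : ℝ} (h : IsAlgebraicUnit x) (N : ℕ) : IsAlgebraicUnit (x ^ N) :=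
  ⟨pow_ne_zero _ h.1, h.2.1.pow N, by rw [← inv_pow]; exact h.2.2.pow N⟩

/-- When `α` and `δ` are conjugate one minimal polynomial suffices, as the product would have double
roots; otherwise the two are coprime. -/
theorem exists_separable_polynomial {α δ : ℝ} (hα : IsAlgebraicUnit α) (hδ : IsAlgebraicUnit δ) :
    ∃ f : ℤ[X], f.Monic ∧ IsUnit (f.coeff 0) ∧ (f.map (algebraMap ℤ ℂ)).Separable ∧
      ∀ z : ℂ, aeval z f = 0 ↔ IsConjRoot ℚ (α : ℂ) z ∨ IsConjRoot ℚ (δ : ℂ) z := by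
  have iα := isIntegral_ofReal hα.2.1
  have iδ := isIntegral_ofReal hδ.2.1
  by_cases h : IsConjRoot ℚ (α : ℂ) (δ : ℂ)
  · refine ⟨minpoly ℤ (α : ℂ), minpoly.monic iα, isUnit_coeff_zero_minpoly hα,
      separable_map_minpoly_int iα, fun z => ?_⟩
    rw [aeval_minpoly_int_eq_zero_iff iα]
    exact ⟨Or.inl, fun h' => h'.elim id h.trans⟩
  · refine ⟨minpoly ℤ (α : ℂ) * minpoly ℤ (δ : ℂ), (minpoly.monic iα).mul (minpoly.monic iδ),
      ?_, ?_, fun z => ?_⟩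
    · rw [mul_coeff_zero]
      exact (isUnit_coeff_zero_minpoly hα).mul (isUnit_coeff_zero_minpoly hδ)
    · rw [Polynomial.map_mul]
      refine (separable_map_minpoly_int iα).mul (separable_map_minpoly_int iδ) ?_
      rw [IsScalarTower.algebraMap_eq ℤ ℚ ℂ, ← Polynomial.map_map, ← Polynomial.map_map,
        map_minpoly_int iα, map_minpoly_int iδ]
      refine IsCoprime.map ?_ (mapRingHom (algebraMap ℚ ℂ))
      have irα := minpoly.irreducible (A := ℚ) iα.tower_top
      have irδ := minpoly.irreducible (A := ℚ) iδ.tower_top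
      rw [irα.coprime_iff_not_dvd]
      exact fun hdvd => h (eq_of_monic_of_associated (minpoly.monic iα.tower_top)
        (minpoly.monic iδ.tower_top) (irα.associated_of_dvd irδ hdvd))
    · rw [map_mul, mul_eq_zero, aeval_minpoly_int_eq_zero_iff iα, aeval_minpoly_int_eq_zero_iff iδ]

/-- There are finitely many conjugates, so the product of the exponents of their roots of unity
serves as a common exponent. -/
theorem exists_pow_eq_of_extremal {a b : ℝ} (hw : IsWeakConjugatePinchingPair a b)
    (he : ExtremalConjugatesAreRootMultiples a b) :
    ∃ N : ℕ, 0 < N ∧ ∀ z : ℂ, IsConjOfPair a b z → (‖z‖ = a ∨ ‖z‖ = b⁻¹) →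
      z ^ N = ((a ^ N : ℝ) : ℂ) ∨ z ^ N = ((b⁻¹ ^ N : ℝ) : ℂ) := by
  classical
  obtain ⟨f, hf, -, -, hfz⟩ := exists_separable_polynomial hw.unit_left hw.unit_right
  have hmem : ∀ z, IsConjOfPair a b z → z ∈ (f.map (algebraMap ℤ ℂ)).roots.toFinset := fun z hz => by
    rw [Multiset.mem_toFinset, mem_roots (hf.map _).ne_zero, IsRoot.def, eval_map_algebraMap]
    exact (hfz z).2 hz
  have hk : ∀ z : ℂ, ∃ k : ℕ, 0 < k ∧ (IsConjOfPair a b z → (‖z‖ = a ∨ ‖z‖ = b⁻¹) →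
      z ^ k = (a : ℂ) ^ k ∨ z ^ k = ((b⁻¹ : ℝ) : ℂ) ^ k) := by
    intro z
    by_cases hz : IsConjOfPair a b z ∧ (‖z‖ = a ∨ ‖z‖ = b⁻¹)
    · obtain ⟨ζ, ⟨k, hk, hζ⟩, h⟩ := he z hz.1 hz.2
      refine ⟨k, hk, fun _ _ => h.imp ?_ ?_⟩ <;>
      · intro h
        rw [h, mul_pow, hζ, mul_one]
    · exact ⟨1, one_pos, fun h1 h2 => absurd ⟨h1, h2⟩ hz⟩
  choose k hk0 hk using hk
  refine ⟨∏ z ∈ (f.map (algebraMap ℤ ℂ)).roots.toFinset, k z, Finset.prod_pos fun z _ => hk0 z,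
    fun z hz hext => ?_⟩
  obtain ⟨l, hl⟩ := Finset.dvd_prod_of_mem k (hmem z hz)
  rw [hl, Complex.ofReal_pow, Complex.ofReal_pow, pow_mul, pow_mul, pow_mul]
  exact (hk z hz hext).imp (fun h => by rw [h]) (fun h => by rw [h])

end Conjugates

/-! ### Sufficiency and the equivalence. -/

theorem IsConjugatePinchingPair.weak {a b : ℝ} (h : IsConjugatePinchingPair a b) :
    IsWeakConjugatePinchingPair a b ∧ ExtremalConjugatesAreRootMultiples a b := by
  have ha : ‖(a : ℂ)‖ = a := by rw [Complex.norm_real, Real.norm_eq_abs, abs_of_pos h.pos_left]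
  have hb : ‖((b⁻¹ : ℝ) : ℂ)‖ = b⁻¹ := by
    rw [Complex.norm_real, Real.norm_eq_abs, abs_of_pos (inv_pos.2 h.pos_right)]
  refine ⟨⟨h.pos_left, h.pos_right, h.unit_left, h.unit_right, fun z hz => ?_⟩,
    fun z hz hext => ⟨1, ⟨1, one_pos, one_pow 1⟩, ?_⟩⟩
  · by_cases h1 : z = (a : ℂ)
    · rw [h1, ha]; exact ⟨h.radius_le, le_rfl⟩
    by_cases h2 : z = ((b⁻¹ : ℝ) : ℂ)
    · rw [h2, hb]; exact ⟨le_rfl, h.radius_le⟩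
    exact ⟨(h.conj_mem z hz h1 h2).1.le, (h.conj_mem z hz h1 h2).2.le⟩
  · rw [mul_one, mul_one]
    by_contra! hne
    have := h.conj_mem z hz hne.1 hne.2
    rcases hext with he | he <;> linarith [this.1, this.2]

theorem isBipositiveEigenvaluePair_one : IsBipositiveEigenvaluePair 1 1 := by
  refine isBipositiveEigenvaluePair_of_matrix (ι := Unit) one_pos one_pos ∅ 1 1 (one_mul 1)
    (one_mul 1) (fun i j => by simp) (fun i j => by simp [flipSign]) (fun _ => 1) (fun _ => 1)
    (fun _ => one_pos) (fun _ => by simp [flipSign]) ?_ ?_ <;> simp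

theorem IsWeakConjugatePinchingPair.isBipositiveEigenvaluePair {a b : ℝ}
    (hw : IsWeakConjugatePinchingPair a b) (he : ExtremalConjugatesAreRootMultiples a b) :
    IsBipositiveEigenvaluePair a b := by
  have ha0 := hw.pos_left
  have hbi0 : 0 < b⁻¹ := inv_pos.2 hw.pos_right
  have na : ‖(a : ℂ)‖ = a := by rw [Complex.norm_real, Real.norm_eq_abs, abs_of_pos ha0]
  have nb : ‖((b⁻¹ : ℝ) : ℂ)‖ = b⁻¹ := by
    rw [Complex.norm_real, Real.norm_eq_abs, abs_of_pos hbi0]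
  have hle : b⁻¹ ≤ a := by
    have := (hw.conj_mem a (Or.inl IsConjRoot.refl)).1
    rwa [na] at this
  -- All conjugates of the unit `b⁻¹` have modulus at most 1 while their product has modulus 1, so
  -- `1 ≤ b⁻¹ ≤ a ≤ 1`. The case `b ≤ 1` reduces to this one through the conjugates of `a`.
  have hone : a ≤ 1 → IsBipositiveEigenvaluePair a b := by
    intro ha1
    have h1 := one_le_norm_of_conj_norm_le_one hw.unit_right
      fun z hz => (hw.conj_mem z (Or.inr hz)).2.trans ha1
    rw [nb] at h1
    have h2 : a = 1 := le_antisymm ha1 (h1.trans hle)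
    have h3 : b⁻¹ = 1 := le_antisymm (hle.trans ha1) h1
    rw [h2, inv_eq_one.1 h3]
    exact isBipositiveEigenvaluePair_one
  rcases le_or_gt a 1 with ha1 | ha1
  · exact hone ha1
  rcases le_or_gt b 1 with hb1 | hb1
  · have h1 := norm_le_one_of_one_le_conj_norm hw.unit_left
      fun z hz => ((one_le_inv₀ hw.pos_right).2 hb1).trans (hw.conj_mem z (Or.inl hz)).1
    rw [na] at h1
    exact hone h1
  obtain ⟨N, hN, hNz⟩ := exists_pow_eq_of_extremal hw he
  obtain ⟨f, hf, hf0, hsep, hfz⟩ :=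
    exists_separable_polynomial (hw.unit_left.pow N) (hw.unit_right.pow N)
  have hroots : ∀ z : ℂ, Polynomial.aeval z f = 0 → z ≠ ((a ^ N : ℝ) : ℂ) →
      z ≠ ((b⁻¹ ^ N : ℝ) : ℂ) → b⁻¹ ^ N < ‖z‖ ∧ ‖z‖ < a ^ N := by
    intro z hz h1 h2
    obtain ⟨y, hy, rfl⟩ : ∃ y, IsConjOfPair a b y ∧ z = y ^ N := by
      rcases (hfz z).1 hz with h | h
      · rw [Complex.ofReal_pow] at h
        obtain ⟨y, hy, e⟩ := exists_isConjRoot_pow_eq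
          (isIntegral_ofReal hw.unit_left.2.1).tower_top h
        exact ⟨y, Or.inl hy, e⟩
      · rw [Complex.ofReal_pow] at h
        obtain ⟨y, hy, e⟩ := exists_isConjRoot_pow_eq
          (isIntegral_ofReal hw.unit_right.2.1).tower_top h
        exact ⟨y, Or.inr hy, e⟩
    -- After the `N`-th power every extremal conjugate becomes `a ^ N` or `b⁻¹ ^ N`, so the
    -- remaining ones lie strictly inside the annulus.
    have hne : ¬(‖y‖ = a ∨ ‖y‖ = b⁻¹) := fun h => (hNz y hy h).elim h1 h2
    push Not at hne
    obtain ⟨l1, l2⟩ := hw.conj_mem y hy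
    rw [norm_pow]
    exact ⟨pow_lt_pow_left₀ (lt_of_le_of_ne l1 hne.2.symm) hbi0.le hN.ne',
      pow_lt_pow_left₀ (lt_of_le_of_ne l2 hne.1) (norm_nonneg y) hN.ne'⟩
  obtain ⟨F, hF, hFne, m, j, c, hpos, hj, hrel⟩ := exists_orbit_relations hf hf0 hsep
    (one_lt_pow₀ ha1 hN.ne') (pow_pos hbi0 N) (pow_lt_one₀ hbi0.le (inv_lt_one_of_one_lt₀ hb1) hN.ne')
    ((hfz _).2 (Or.inl IsConjRoot.refl)) ((hfz _).2 (Or.inr IsConjRoot.refl)) hroots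
  classical
  have := hF.fintype
  have := hFne.to_subtype
  exact isBipositiveEigenvaluePair_of_orbits ha1 hb1 hN j (fun s => (hj s).1) (fun s => (hj s).2) c
    (fun s => Polynomial.aeval (a ^ N) (s : Polynomial ℤ))
    (fun s => Polynomial.aeval (b⁻¹ ^ N) (s : Polynomial ℤ)) (fun s => (hpos s s.2).1)
    (fun s => (hpos s s.2).2) (hrel _ _ (Or.inl rfl)) (hrel _ _ (Or.inr rfl))

theorem mainTheorem4 (a b : ℝ) :
    IsBipositiveEigenvaluePair a b ↔
      IsConjugatePinchingPair a b ∨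
        (IsWeakConjugatePinchingPair a b ∧ ExtremalConjugatesAreRootMultiples a b) := by
  refine ⟨fun h => Or.inr (weak_and_extremal_of_isBipositiveEigenvaluePair h), fun h => ?_⟩
  obtain ⟨hw, he⟩ := h.elim IsConjugatePinchingPair.weak id
  exact hw.isBipositiveEigenvaluePair he
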